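/- **Definitions.** Write $\overline{\log\log}\,k=\max(1,\log_2\log_2 k)$ (with the value $1$ for $k\le 2$). An *$(r,k)$-instance* is a set $K$ of $k\ge 1$ positive integers (node IDs) with $\lfloor\sum_{v\in K}\log_2 v\rfloor=r$, together with a wake-up function $\omega:K\to\mathbb N$; put $\omega(K)=\min_{v\in K}\omega(v)$. For $h:\mathbb N\times\mathbb N\to\mathbb N$, an *unbounded transmission schedule of delay $h$* is a function $T:\mathbb N\times\mathbb N\to\{0,1\}^{\mathbb N}$ such that $T(v,w)_j=0$ whenever $j<w$, and such that for every $(r,k)$-instance $(K,\omega)$ there is a time-step $j\le\omega(K)+h(r,k)$ with $\sum_{v\in K}T(v,\omega(v))_j=1$. We say $h(r,k)=O(r\log\log k)$ if there is a constant $C$ with $h(r,k)\le C\max(1,r)\,\overline{\log\log}\,k$ for all $r,k$. A *radio network* is a finite directed graph on $n$ nodes in which every node is reachable from every other, whose nodes carry distinct IDs from $\{1,\dots,L\}$. Time is divided into steps $0,1,2,\dots$, and a global clock is available. All nodes are dormant at first; a non-empty set of nodes wakes up spontaneously, at arbitrary time-steps (unless woken earlier by a message). In each step an awake node either transmits or listens;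 dormant nodes listen. A listening node receives a message in a step iff exactly one of its in-neighbours transmits in that step; a dormant node that receives a message in step $t$ is awake from step $t+1$ on. Let $\omega(v)$ be the first time-step in which $v$ is awake. In the *schedule-based broadcasting algorithm with schedule $T$*, an awake node with ID $v$ transmits in step $j$ iff $T(v,\omega(v))_j=1$ (so it uses only its own ID, its wake-up time and the global clock, and knows neither $n$ nor $L$). **Theorem.** There exists an unbounded transmission schedule of some delay $h$ with $h(r,k)=O(r\log\log k)$. Moreover, for every unbounded transmission schedule $T$ of delay $h$ with $h(r,k)=O(r\log\log k)$ there is a constant $C$ such that in every radio network with $n$ nodes and IDs from $\{1,\dots,L\}$, and for every pattern of spontaneous wake-ups, the schedule-based broadcasting algorithm with schedule $T$ has all nodes awake (informed) within $$C\,n\,\log_2 L\;\overline{\log\log}\,n$$ time-steps after the first node wakes up, i.e. in time $O(n\log L\log\log n)$. -/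

import Mathlib

/-- `log₂ log₂ k`, read as at least `1` (the iterated logarithm is negative, zero or undefined
for small `k`). -/
noncomputable def logLog (k : ℕ) : ℝ := max 1 (Real.logb 2 (Real.logb 2 (k : ℝ)))

/-- The set underlying an `(r, k)`-instance: `k ≥ 1` nodes, identified with their (positive) IDs,
whose binary logarithms sum to `r` after rounding down. -/
def IsInstance (r k : ℕ) (K : Finset ℕ) : Prop :=
  K.Nonempty ∧ (∀ v ∈ K, 1 ≤ v) ∧ K.card = k ∧ ⌊∑ v ∈ K, Real.logb 2 (v : ℝ)⌋₊ = r

/-- `T v w j` says whether the node with ID `v`, woken in time-step `w`, transmits in the global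
time-step `j`. `T` is an unbounded transmission schedule of delay `h` if no node transmits before
it is awake, and, for every instance `K` and every wake-up function `ω`, exactly one node of `K`
transmits in some time-step `j ≤ ω(K) + h(r, k)`, where `ω(K)` is the minimum of `ω` on `K`. -/
def IsTransmissionSchedule (T : ℕ → ℕ → ℕ → Bool) (h : ℕ → ℕ → ℕ) : Prop :=
  (∀ v w j, j < w → T v w j = false) ∧
  ∀ (r k : ℕ) (K : Finset ℕ) (hK : IsInstance r k K) (ω : ℕ → ℕ),
    ∃ j ≤ K.inf' hK.1 ω + h r k, (K.filter fun v => T v (ω v) j = true).card = 1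

/-- `h(r, k) = O(r log log k)`, with both factors read as at least `1`. -/
def IsDelayBigO (h : ℕ → ℕ → ℕ) : Prop :=
  ∃ C : ℝ, ∀ r k : ℕ, (h r k : ℝ) ≤ C * max 1 (r : ℝ) * logLog k

/-- A directed radio network: `graph.Adj v u` means that `v` can send directly to `u`. Nodes carry
distinct positive IDs, and every node is reachable from every other one. -/
structure RadioNetwork (V : Type*) where
  graph : Digraph V
  id : V → ℕ
  id_pos : ∀ v, 1 ≤ id v
  id_injective : Function.Injective id
  reachable : ∀ u v, Relation.ReflTransGen graph.Adj u v

namespace RadioNetwork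

variable {V : Type*}

/-- Given the wake-up times recorded so far (`none`: still dormant), node `v` transmits in
time-step `t` iff it is awake and the schedule, fed only with its ID, its wake-up time and the
global clock, tells it to. -/
def Transmits (N : RadioNetwork V) (T : ℕ → ℕ → ℕ → Bool) (s : V → Option ℕ) (t : ℕ) (v : V) :
    Prop :=
  ∃ w, s v = some w ∧ T (N.id v) w t = true

/-- Node `v` receives a message in time-step `t`: it listens, and exactly one in-neighbour
transmits. -/
def Hears (N : RadioNetwork V) (T : ℕ → ℕ → ℕ → Bool) (s : V → Option ℕ) (t : ℕ) (v : V) :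
    Prop :=
  ¬ N.Transmits T s t v ∧ ∃! u, N.graph.Adj u v ∧ N.Transmits T s t u

open Classical in
/-- The execution of the schedule `T` on `N`. `σ v` is the time-step at which `v` would wake up
spontaneously (`none`: never). `N.run T σ t v` is the time-step in which `v` woke up, if that is at
most `t`, and `none` otherwise. A dormant node that receives a message in time-step `t` is awake
from time-step `t + 1` on. -/
noncomputable def run (N : RadioNetwork V) (T : ℕ → ℕ → ℕ → Bool) (σ : V → Option ℕ) :
    ℕ → V → Option ℕ
  | 0, v => if σ v = some 0 then some 0 else none
  | t + 1, v =>
    match run N T σ t v with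
    | some w => some w
    | none =>
      if σ v = some (t + 1) ∨ N.Hears T (run N T σ t) t v then some (t + 1) else none

end RadioNetwork

/-!
# Transmission schedules of delay `O(r log log k)` and broadcasting

**Broadcasting.** Fix a walk `p 0, …, p D` from a node that is awake to a target, and sort the
in-neighbours of the walk into disjoint layers: a node lies in layer `i` if `p i` is the last node
of the walk that it can send to. Once some node of layer `i` is awake, and as long as no later layer
is, only layer `i` can reach `p i`, so a transmission schedule wakes `p i` within its delay on that
layer; but `p i` lies in a later layer itself, or is the target (`RadioNetwork.layer_progress`).
A layer of `k` nodes has `r ≤ k log₂ L`, so the delays of the layers add up to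
`O(n log L log log n)` (`RadioNetwork.isSome_run_of_layer`, `broadcast_time`).

**Existence.** The schedule is random. A node of weight `ℓ` (the length of its ID) and age `x`
transmits with probability about `Λ m ℓ 2⁻ᵉ / (x + ℓ)`, where the period `m = period i` is about
`log log (x / ℓ)` and the attenuation level `e` is the global time modulo `m`. Periods are powers of
two and change only at multiples of themselves. As a result the load, which is the expected number of
transmitters, falls at most by the factor `4` per step (`load_le_four_mul_succ`).

Consider an instance at its critical time `τ`, the first time at which `τ ≥ C A W` for the total
weight `W` of the nodes awake and `A ≈ log log k` for their number `k` (`exists_isCritical`). Divide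
time into blocks of length `4 A`.
* In the last step of a block all relevant nodes are at their last level. The load at last levels
  sums to `O(W)` over all time, so it is small for most blocks (`card_bad_blocks_le`).
* If the load is small in the last step but not throughout a block, then it passes through a
  constant range, in which a single node transmits with constant probability
  (`sum_soloProb_of_heavy`).
* If the load is small throughout, then the probability of a single transmitter is comparable to the
  load, which adds up to a constant over the block, because before the critical time the weight awake
  at time `t` exceeds `t / (C A)` (`sum_soloProb_of_light`).

Hence the expected number of steps with a single transmitter is a large multiple of `τ / (C A) ≥ W`
(`le_sum_soloProb`). This exceeds the logarithm of the number of choices of the IDs, of the wake-up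
times relative to the start, and of `τ` (`IsCritical.entropy_le`). The starting time itself is
unbounded, but the schedule depends on the clock only modulo a power of two that is at most `τ`
(`bitSchedule_add`). A union bound leaves a positive probability that the schedule fails for no
critical instance (`exists_forall_notMem_badEventAt`); every instance contains a critical one.
-/

/-! ### Broadcasting by a transmission schedule -/

lemma one_le_logLog (k : ℕ) : 1 ≤ logLog k := le_max_left _ _

lemma logLog_mono {k n : ℕ} (hkn : k ≤ n) : logLog k ≤ logLog n := by
  rcases le_or_gt k 1 with hk | hk
  · have : logLog k = 1 := by
      interval_cases k <;> simp [logLog]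
    rw [this]
    exact one_le_logLog n
  · have h2 : (2 : ℝ) ≤ k := by exact_mod_cast hk
    have hkn' : (k : ℝ) ≤ n := by exact_mod_cast hkn
    have h1 : (0 : ℝ) < Real.logb 2 k := Real.logb_pos one_lt_two (by linarith)
    exact max_le_max le_rfl (Real.logb_le_logb_of_le one_lt_two h1
      (Real.logb_le_logb_of_le one_lt_two (by linarith) hkn'))

/-- Every delay of order `r log log k` is bounded with a positive constant. -/
lemma IsDelayBigO.exists_pos {h : ℕ → ℕ → ℕ} (hh : IsDelayBigO h) :
    ∃ C : ℝ, 0 < C ∧ ∀ r k : ℕ, (h r k : ℝ) ≤ C * max 1 (r : ℝ) * logLog k := by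
  obtain ⟨C, hC⟩ := hh
  refine ⟨max C 1, by positivity, fun r k => (hC r k).trans ?_⟩
  have := one_le_logLog k
  gcongr
  exact le_max_left _ _

/-- A walk in a relation, as a sequence. -/
lemma Relation.ReflTransGen.exists_seq {V : Type*} {R : V → V → Prop} {u v : V}
    (huv : Relation.ReflTransGen R u v) :
    ∃ (D : ℕ) (p : ℕ → V), p 0 = u ∧ p D = v ∧ ∀ i < D, R (p i) (p (i + 1)) := by
  induction huv with
  | refl => exact ⟨0, fun _ => u, rfl, rfl, by simp⟩
  | @tail b c _ hbc ih =>
    obtain ⟨D, p, h0, hD, hp⟩ := ih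
    refine ⟨D + 1, fun i => if i ≤ D then p i else c, by simp [h0], by simp, fun i hi => ?_⟩
    rcases Nat.lt_succ_iff_lt_or_eq.mp hi with h | rfl
    · simpa [h.le, Nat.succ_le_of_lt h] using hp i h
    · simpa [hD] using hbc

namespace RadioNetwork

variable {V : Type*} (N : RadioNetwork V) (T : ℕ → ℕ → ℕ → Bool) (σ : V → Option ℕ)

lemma run_succ_of_eq_some {t w : ℕ} {v : V} (h : N.run T σ t v = some w) :
    N.run T σ (t + 1) v = some w := by
  simp [run, h]

lemma run_of_le {t t' w : ℕ} {v : V} (htt' : t ≤ t') (h : N.run T σ t v = some w) :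
    N.run T σ t' v = some w := by
  induction htt' with
  | refl => exact h
  | step _ ih => exact N.run_succ_of_eq_some T σ ih

lemma isSome_run_of_le {t t' : ℕ} {v : V} (htt' : t ≤ t') (h : (N.run T σ t v).isSome) :
    (N.run T σ t' v).isSome := by
  obtain ⟨w, hw⟩ := Option.isSome_iff_exists.mp h
  rw [N.run_of_le T σ htt' hw]
  rfl

lemma le_of_run_eq_some {t w : ℕ} {v : V} (h : N.run T σ t v = some w) : w ≤ t := by
  induction t with
  | zero =>
    by_cases h0 : σ v = some 0 <;> simp_all [run]
  | succ t ih =>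
    cases hr : N.run T σ t v with
    | some w' =>
      rw [N.run_succ_of_eq_some T σ hr] at h
      have := ih (hr.trans h)
      omega
    | none =>
      simp only [run, hr] at h
      split_ifs at h
      simp_all

/-- Wake-up times recorded by the execution do not depend on the moment of observation. -/
lemma run_eq_some_of_le {t t' w : ℕ} {v : V} (h : N.run T σ t v = some w) (hw : w ≤ t') :
    N.run T σ t' v = some w := by
  rcases le_total t t' with htt' | htt'
  · exact N.run_of_le T σ htt' h
  · induction htt' with
    | refl => exact h
    | @step t htt' ih =>
      refine ih ?_
      cases hr : N.run T σ t v with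
      | some w' => rw [N.run_succ_of_eq_some T σ hr] at h; exact h
      | none =>
        simp only [run, hr] at h
        have htt'' : t' ≤ t := htt'
        split_ifs at h
        simp at h
        omega

lemma isSome_run_of_spontaneous {t : ℕ} {v : V} (h : σ v = some t) :
    (N.run T σ t v).isSome := by
  cases t with
  | zero => simp [run, h]
  | succ t =>
    cases hr : N.run T σ t v with
    | some w => rw [N.run_succ_of_eq_some T σ hr]; rfl
    | none => simp [run, hr, h]

/-- If exactly one in-neighbour of `v` transmits in step `t`, then `v` is awake in step
`t + 1`: it was awake before or it receives the message. -/
lemma isSome_run_succ_of_existsUnique {t : ℕ} {v : V}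
    (h : ∃! u, N.graph.Adj u v ∧ N.Transmits T (N.run T σ t) t u) :
    (N.run T σ (t + 1) v).isSome := by
  cases hr : N.run T σ t v with
  | some w => rw [N.run_succ_of_eq_some T σ hr]; rfl
  | none =>
    have : N.Hears T (N.run T σ t) t v := by
      refine ⟨?_, h⟩
      rintro ⟨w, hw, _⟩
      simp [hr] at hw
    simp [run, hr, this]

open Classical in
/-- The `i`-th layer along the walk `p 0, …, p D`: the in-neighbours of `p i` that are not
in-neighbours of a later node of the walk. -/
noncomputable def layer [Fintype V] (p : ℕ → V) (D i : ℕ) : Finset V :=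
  {v | N.graph.Adj v (p i) ∧ ∀ i', i < i' → i' ≤ D → ¬ N.graph.Adj v (p i')}

variable [Fintype V]

lemma exists_mem_layer {p : ℕ → V} {D i : ℕ} {v : V} (hi : i ≤ D) (hv : N.graph.Adj v (p i)) :
    ∃ i', i ≤ i' ∧ i' ≤ D ∧ v ∈ N.layer p D i' := by
  classical
  have hspec := Nat.findGreatest_spec (P := fun i => N.graph.Adj v (p i)) hi hv
  refine ⟨Nat.findGreatest (fun i => N.graph.Adj v (p i)) D, Nat.le_findGreatest hi hv,
    Nat.findGreatest_le D, ?_⟩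
  simp only [layer, Finset.mem_filter, Finset.mem_univ, true_and]
  exact ⟨hspec, fun i' h1 h2 => Nat.findGreatest_is_greatest h1 h2⟩

lemma disjoint_layer {p : ℕ → V} {D i j : ℕ} (hi : i ≤ D) (hj : j ≤ D) (hij : i ≠ j) :
    Disjoint (N.layer p D i) (N.layer p D j) := by
  rw [Finset.disjoint_left]
  intro v hv hv'
  simp only [layer, Finset.mem_filter, Finset.mem_univ, true_and] at hv hv'
  rcases lt_or_gt_of_ne hij with h | h
  · exact hv.2 j h hj hv'.1
  · exact hv'.2 i h hi hv.1

lemma sum_card_layer_le (p : ℕ → V) (D : ℕ) :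
    ∑ i ∈ Finset.range (D + 1), (N.layer p D i).card ≤ Fintype.card V := by
  classical
  rw [← Finset.card_biUnion]
  · exact Finset.card_le_univ _
  · intro i hi j hj hij
    simp only [Finset.coe_range, Set.mem_Iio] at hi hj
    exact N.disjoint_layer (by omega) (by omega) hij

/-- While no later layer is awake, the awake in-neighbours of `p i` all lie in layer `i`, so the
schedule isolates one of them within its delay on that layer. -/
lemma layer_progress {T : ℕ → ℕ → ℕ → Bool} {h : ℕ → ℕ → ℕ} (hT : IsTransmissionSchedule T h)
    {p : ℕ → V} {D i t : ℕ} {v : V} (hv : v ∈ N.layer p D i)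
    (hawake : (N.run T σ t v).isSome) {r k : ℕ}
    (hK : IsInstance r k ((N.layer p D i).map ⟨N.id, N.id_injective⟩)) :
    (N.run T σ (t + h r k + 1) (p i)).isSome ∨
      ∃ i' u, i < i' ∧ i' ≤ D ∧ u ∈ N.layer p D i' ∧ (N.run T σ (t + h r k + 1) u).isSome := by
  classical
  by_contra! hcon
  obtain ⟨hpi, hlater⟩ := hcon
  set d := t + h r k with hd
  -- Nodes that are still dormant at the deadline `d` get a wake-up time after it.
  set ω : ℕ → ℕ := fun a =>
    if ha : ∃ u, N.id u = a then (N.run T σ d ha.choose).getD (d + 1) else d + 1 with hω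
  have hωid : ∀ u, ω (N.id u) = (N.run T σ d u).getD (d + 1) := by
    intro u
    have ha : ∃ u', N.id u' = N.id u := ⟨u, rfl⟩
    have : ha.choose = u := N.id_injective ha.choose_spec
    simp only [hω, dif_pos ha, this]
  obtain ⟨j, hj, hcard⟩ := hT.2 r k _ hK ω
  have hinf : Finset.inf' _ hK.1 ω ≤ t := by
    obtain ⟨w, hw⟩ := Option.isSome_iff_exists.mp hawake
    refine (Finset.inf'_le ω (Finset.mem_map_of_mem ⟨N.id, N.id_injective⟩ hv)).trans ?_
    have hwt := N.le_of_run_eq_some T σ hw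
    have : ω (N.id v) = w := by
      rw [hωid, N.run_of_le T σ (by omega : t ≤ d) hw]; rfl
    simpa [this] using hwt
  have hjd : j ≤ d := by omega
  have htrans : ∀ u, N.Transmits T (N.run T σ j) j u ↔ T (N.id u) (ω (N.id u)) j = true := by
    intro u
    constructor
    · rintro ⟨w, hw, hTw⟩
      rwa [hωid, N.run_of_le T σ hjd hw]
    · intro hTu
      have hle : ω (N.id u) ≤ j := by
        by_contra hlt
        rw [hT.1 _ _ _ (not_le.mp hlt)] at hTu
        exact absurd hTu (by simp)
      cases hr : N.run T σ d u with
      | none => rw [hωid, hr] at hle; simp at hle; omega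
      | some w =>
        rw [hωid, hr] at hTu hle
        exact ⟨w, N.run_eq_some_of_le T σ hr hle, hTu⟩
  apply hpi
  refine N.isSome_run_of_le T σ (by omega : j + 1 ≤ d + 1)
    (N.isSome_run_succ_of_existsUnique T σ ?_)
  obtain ⟨a, ha⟩ := Finset.card_eq_one.mp hcard
  have hamem := Finset.mem_singleton_self a
  rw [← ha, Finset.mem_filter, Finset.mem_map] at hamem
  obtain ⟨⟨u, hu, rfl⟩, hTu⟩ := hamem
  refine ⟨u, ⟨?_, (htrans u).mpr hTu⟩, ?_⟩
  · simp only [layer, Finset.mem_filter] at hu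
    exact hu.2.1
  · rintro u' ⟨hadj, htr⟩
    have hmem : u' ∈ N.layer p D i := by
      simp only [layer, Finset.mem_filter, Finset.mem_univ, true_and]
      refine ⟨hadj, fun i' h1 h2 hadj' => ?_⟩
      obtain ⟨i'', h3, h4, h5⟩ := N.exists_mem_layer h2 hadj'
      refine absurd ?_ (hlater i'' u' (by omega) h4 h5)
      obtain ⟨w, hw, -⟩ := htr
      rw [N.run_of_le T σ (by omega : j ≤ d + 1) hw]
      rfl
    have : N.id u' ∈ ({N.id u} : Finset ℕ) := by
      rw [show N.id u = (⟨N.id, N.id_injective⟩ : V ↪ ℕ) u from rfl, ← ha, Finset.mem_filter]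
      exact ⟨Finset.mem_map_of_mem ⟨N.id, N.id_injective⟩ hmem, (htrans u').mp htr⟩
    exact N.id_injective (Finset.mem_singleton.mp this)

/-- The front of the execution moves along the walk: a bound `c i` for the delay on each non-empty
layer `i` adds up to a bound for reaching the end of the walk. -/
lemma isSome_run_of_layer {T : ℕ → ℕ → ℕ → Bool} {h : ℕ → ℕ → ℕ}
    (hT : IsTransmissionSchedule T h) {p : ℕ → V} {D : ℕ}
    (hp : ∀ i < D, N.graph.Adj (p i) (p (i + 1))) (c : ℕ → ℕ)
    (hc : ∀ i ≤ D, (N.layer p D i).Nonempty →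
      ∃ r k, IsInstance r k ((N.layer p D i).map ⟨N.id, N.id_injective⟩) ∧ h r k + 1 ≤ c i)
    (n : ℕ) : ∀ (i t : ℕ) (v : V), i ≤ D → D < i + n → v ∈ N.layer p D i →
      (N.run T σ t v).isSome → (N.run T σ (t + ∑ i' ∈ Finset.Ico i (D + 1), c i') (p D)).isSome := by
  induction n with
  | zero => intro i t v h1 h2; omega
  | succ n ih =>
    intro i t v hi hn hv hawake
    obtain ⟨r, k, hK, hrk⟩ := hc i hi ⟨v, hv⟩
    rw [Finset.sum_eq_sum_Ico_succ_bot (by omega)]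
    have later : ∀ i' u, i < i' → i' ≤ D → u ∈ N.layer p D i' →
        (N.run T σ (t + h r k + 1) u).isSome →
        (N.run T σ (t + (c i + ∑ i' ∈ Finset.Ico (i + 1) (D + 1), c i')) (p D)).isSome := by
      intro i' u h1 h2 h3 h4
      refine N.isSome_run_of_le T σ ?_ (ih i' _ u h2 (by omega) h3 h4)
      have : ∑ i'' ∈ Finset.Ico i' (D + 1), c i'' ≤ ∑ i'' ∈ Finset.Ico (i + 1) (D + 1), c i'' :=
        Finset.sum_le_sum_of_subset (Finset.Ico_subset_Ico (by omega) le_rfl)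
      omega
    rcases N.layer_progress σ hT hv hawake hK with h | ⟨i', u, h1, h2, h3, h4⟩
    · rcases hi.lt_or_eq with hlt | rfl
      · obtain ⟨i', h1, h2, h3⟩ := N.exists_mem_layer (D := D) (by omega) (hp i hlt)
        exact later i' _ (by omega) h2 h3 h
      · exact N.isSome_run_of_le T σ (by omega) h
    · exact later i' u h1 h2 h3 h4

end RadioNetwork

/-- Sets of `k` IDs up to `L` have `r ≤ k log₂ L`, whence their delay. -/
lemma delay_le_of_id_le {h : ℕ → ℕ → ℕ} {C : ℝ} (hC : 0 < C)
    (hh : ∀ r k : ℕ, (h r k : ℝ) ≤ C * max 1 (r : ℝ) * logLog k) {K : Finset ℕ} {L n : ℕ}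
    (hK : K.Nonempty) (hKpos : ∀ v ∈ K, 1 ≤ v) (hKL : ∀ v ∈ K, v ≤ L) (hL : 2 ≤ L)
    (hn : K.card ≤ n) :
    ∃ r k, IsInstance r k K ∧
      ((h r k + 1 : ℕ) : ℝ) ≤ K.card * ((C + 1) * Real.logb 2 L * logLog n) := by
  refine ⟨_, _, ⟨hK, hKpos, rfl, rfl⟩, ?_⟩
  set r := ⌊∑ v ∈ K, Real.logb 2 (v : ℝ)⌋₊
  have hL' : (1 : ℝ) ≤ Real.logb 2 L := by
    rw [Real.le_logb_iff_rpow_le one_lt_two (by positivity)]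
    simpa using hL
  have hsum : ∑ v ∈ K, Real.logb 2 (v : ℝ) ≤ K.card * Real.logb 2 L := by
    rw [← nsmul_eq_mul]
    refine Finset.sum_le_card_nsmul _ _ _ fun v hv => ?_
    have h1 : (1 : ℝ) ≤ v := by exact_mod_cast hKpos v hv
    exact Real.logb_le_logb_of_le one_lt_two (by linarith) (by exact_mod_cast hKL v hv)
  have hcard : (1 : ℝ) ≤ K.card := by exact_mod_cast hK.card_pos
  have hone : 1 ≤ (K.card : ℝ) * Real.logb 2 L := one_le_mul_of_one_le_of_one_le hcard hL'
  have hr : (r : ℝ) ≤ K.card * Real.logb 2 L := by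
    refine (Nat.floor_le (Finset.sum_nonneg fun v hv => ?_)).trans hsum
    exact Real.logb_nonneg one_lt_two (by exact_mod_cast hKpos v hv)
  have h1 := one_le_logLog n
  have h2 := logLog_mono hn
  have h3 := one_le_logLog K.card
  have := hh r K.card
  push_cast
  calc (h r K.card : ℝ) + 1
      ≤ C * (K.card * Real.logb 2 L) * logLog n + (K.card * Real.logb 2 L) * logLog n := by
        refine add_le_add (this.trans ?_) (one_le_mul_of_one_le_of_one_le hone h1)
        gcongr
        exact max_le hone hr
    _ = _ := by ring

/-- Broadcasting with a schedule of delay `O(r log log k)`. -/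
theorem broadcast_time {T : ℕ → ℕ → ℕ → Bool} {h : ℕ → ℕ → ℕ} (hT : IsTransmissionSchedule T h)
    (hh : IsDelayBigO h) :
    ∃ C : ℝ, ∀ (V : Type*) [Fintype V] (N : RadioNetwork V) (L : ℕ), (∀ v, N.id v ≤ L) →
      ∀ (σ : V → Option ℕ) (t₀ : ℕ), IsLeast {t | ∃ v, σ v = some t} t₀ →
        ∃ t : ℕ,
          (t : ℝ) ≤ t₀ + C * Fintype.card V * Real.logb 2 (L : ℝ) * logLog (Fintype.card V) ∧
          ∀ v, (N.run T σ t v).isSome := by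
  obtain ⟨C, hC0, hC⟩ := hh.exists_pos
  refine ⟨C + 1, fun V _ N L hNL σ t₀ hleast => ?_⟩
  obtain ⟨⟨v₀, hv₀⟩, -⟩ := hleast
  have hstart := N.isSome_run_of_spontaneous T σ hv₀
  have hLpos : 1 ≤ L := (N.id_pos v₀).trans (hNL v₀)
  set B : ℝ := (C + 1) * Fintype.card V * Real.logb 2 (L : ℝ) * logLog (Fintype.card V) with hB
  have hlog : 0 ≤ Real.logb 2 (L : ℝ) := Real.logb_nonneg one_lt_two (by exact_mod_cast hLpos)
  have hll := one_le_logLog (Fintype.card V)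
  have hB0 : 0 ≤ B := by positivity
  refine ⟨t₀ + ⌊B⌋₊, by push_cast; linarith [Nat.floor_le hB0], fun v => ?_⟩
  by_cases hvv : v = v₀
  · subst hvv
    exact N.isSome_run_of_le T σ (by omega) hstart
  have hL2 : 2 ≤ L := by
    by_contra hlt
    apply hvv
    apply N.id_injective
    have := N.id_pos v; have := N.id_pos v₀; have := hNL v; have := hNL v₀
    omega
  obtain ⟨D, p, hp0, hpD, hp⟩ := (N.reachable v₀ v).exists_seq
  have hD : 0 < D := by
    rcases Nat.eq_zero_or_pos D with rfl | h
    · exact absurd (hpD.symm.trans hp0) hvv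
    · exact h
  set b : ℝ := (C + 1) * Real.logb 2 L * logLog (Fintype.card V) with hb
  have hb0 : 0 ≤ b := by positivity
  obtain ⟨i, hi1, hiD, hi⟩ := N.exists_mem_layer (D := D) (i := 1) (by omega) (hp 0 hD)
  rw [hp0] at hi
  have key := N.isSome_run_of_layer σ hT hp (fun i => ⌊(N.layer p D i).card * b⌋₊) (fun i hi hne => by
      obtain ⟨r, k, hK, hle⟩ := delay_le_of_id_le (n := Fintype.card V) (L := L) hC0 hC
        (K := (N.layer p D i).map ⟨N.id, N.id_injective⟩) (by simpa using hne)
        (by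
          intro a ha
          obtain ⟨u, _, rfl⟩ := Finset.mem_map.mp ha
          exact N.id_pos u)
        (by
          intro a ha
          obtain ⟨u, _, rfl⟩ := Finset.mem_map.mp ha
          exact hNL u) hL2 (by simpa using Finset.card_le_univ _)
      rw [Finset.card_map] at hle
      exact ⟨r, k, hK, Nat.le_floor hle⟩) (D + 1) i t₀ v₀ hiD (by omega) hi hstart
  rw [hpD] at key
  refine N.isSome_run_of_le T σ (Nat.add_le_add_left (Nat.le_floor ?_) _) key
  push_cast
  calc ∑ i' ∈ Finset.Ico i (D + 1), (⌊(N.layer p D i').card * b⌋₊ : ℝ)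
      ≤ ∑ i' ∈ Finset.range (D + 1), (N.layer p D i').card * b := by
        refine (Finset.sum_le_sum_of_subset_of_nonneg (fun x hx => ?_) fun _ _ _ => by positivity).trans
          (Finset.sum_le_sum fun i' _ => Nat.floor_le (by positivity))
        simp at hx ⊢; omega
    _ = ((∑ i' ∈ Finset.range (D + 1), (N.layer p D i').card : ℕ) : ℝ) * b := by
        rw [← Finset.sum_mul]; push_cast; rfl
    _ ≤ Fintype.card V * b := by
        gcongr
        exact N.sum_card_layer_le p D
    _ = B := by rw [hB, hb]; ring

/-! ### The transmission probabilities -/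

/-- The constant by which the transmission probabilities are scaled up. The expected number of
successes up to a critical time grows in proportion to it, while the entropy in the union bound grows
only with its logarithm. -/
def amplitude : ℕ := 2 ^ 15

/-- The constant in the delay of the constructed schedule: `512` times the amplitude, so that at
most half of the blocks before a critical time have a large load in their last step. -/
def delayConst : ℕ := 2 ^ 24

/-- The weight of an ID: its number of binary digits (for positive IDs). -/
def weight (v : ℕ) : ℕ := Nat.log 2 v + 1

/-- The number of attenuation levels which nodes of class `i` run through periodically. -/
def period (i : ℕ) : ℕ := 2 ^ (i + 2)

/-- The age per unit of weight at which a node may enter class `i`. Its iterated logarithm is a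
quarter of `period i`, so that attenuation by `2 ^ period i` outweighs the number of scales
`log (threshold (i + 1))` of the ages spent in class `i`. -/
def threshold (i : ℕ) : ℕ := 2 ^ (2 ^ (2 ^ i))

/-- The class, in time-step `j`, of a node of weight `ℓ` and age `x`: the largest `i` such that at
the last multiple of `period i` the age was already `ℓ * threshold i`, and `0` if there is no such
`i`. -/
def ageClass (ℓ x j : ℕ) : ℕ :=
  Nat.findGreatest (fun i => ℓ * threshold i + j % period i ≤ x) x

/-- The probability with which a node of weight `ℓ`, age `x` and class `i` transmits at attenuation
level `e`. -/
noncomputable def levelProb (ℓ x i e : ℕ) : ℝ :=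
  min (1 / 2) (amplitude * period i * ℓ / ((x + ℓ) * 2 ^ e))

/-- The probability with which a node of weight `ℓ` woken in time-step `w` transmits in time-step
`j`: the attenuation level is read off the global clock. -/
noncomputable def stepProb (ℓ w j : ℕ) : ℝ :=
  if w ≤ j then
    levelProb ℓ (j - w) (ageClass ℓ (j - w) j) (j % period (ageClass ℓ (j - w) j))
  else 0

lemma weight_pos (v : ℕ) : 1 ≤ weight v := Nat.le_add_left _ _

lemma period_pos (i : ℕ) : 0 < period i := by unfold period; positivity

lemma period_mono : Monotone period := fun _ _ h =>
  Nat.pow_le_pow_right two_pos (Nat.add_le_add_right h 2)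

lemma period_dvd {i i' : ℕ} (h : i ≤ i') : period i ∣ period i' :=
  pow_dvd_pow 2 (Nat.add_le_add_right h 2)

lemma threshold_mono : Monotone threshold := fun _ _ h =>
  Nat.pow_le_pow_right two_pos (Nat.pow_le_pow_right two_pos (Nat.pow_le_pow_right two_pos h))

lemma lt_threshold (i : ℕ) : i < threshold i :=
  (Nat.lt_two_pow_self).trans (Nat.lt_two_pow_self.trans Nat.lt_two_pow_self)

/-- The thresholds grow faster than the periods. -/
lemma two_mul_threshold_le (i : ℕ) : 2 * threshold i ≤ threshold (i + 1) := by
  unfold threshold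
  rw [← pow_succ']
  refine Nat.pow_le_pow_right two_pos ?_
  have h1 : 2 ^ i < 2 ^ (i + 1) := Nat.pow_lt_pow_right one_lt_two (Nat.lt_succ_self i)
  exact Nat.pow_lt_pow_right one_lt_two h1

lemma period_succ (i : ℕ) : period (i + 1) = 2 * period i := by
  unfold period; ring

lemma period_le_threshold {i : ℕ} (hi : 1 ≤ i) : period i ≤ threshold i := by
  induction i, hi using Nat.le_induction with
  | base => simp [period, threshold]
  | succ i _ ih =>
    rw [period_succ]
    exact (Nat.mul_le_mul_left 2 ih).trans (two_mul_threshold_le i)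

lemma le_ageClass {ℓ x j i : ℕ} (hℓ : 1 ≤ ℓ) (h : ℓ * threshold i + j % period i ≤ x) :
    i ≤ ageClass ℓ x j := by
  refine Nat.le_findGreatest ?_ h
  have h1 := lt_threshold i
  have h2 := Nat.le_mul_of_pos_left (threshold i) hℓ
  omega

lemma ageClass_spec {ℓ x j : ℕ} (h : 0 < ageClass ℓ x j) :
    ℓ * threshold (ageClass ℓ x j) + j % period (ageClass ℓ x j) ≤ x :=
  Nat.findGreatest_of_ne_zero (P := fun i => ℓ * threshold i + j % period i ≤ x)
    (m := ageClass ℓ x j) rfl h.ne'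

lemma ageClass_le_succ {ℓ : ℕ} (hℓ : 1 ≤ ℓ) (x j : ℕ) :
    ageClass ℓ x j ≤ ageClass ℓ (x + 1) (j + 1) := by
  rcases Nat.eq_zero_or_pos (ageClass ℓ x j) with h | h
  · omega
  · have h1 := ageClass_spec h
    set i := ageClass ℓ x j
    refine le_ageClass hℓ ?_
    have : (j + 1) % period i ≤ j % period i + 1 := by
      rw [Nat.add_mod_eq_ite]
      have := Nat.mod_le 1 (period i)
      split_ifs <;> omega
    omega

lemma ageClass_mono {ℓ w j j' : ℕ} (hℓ : 1 ≤ ℓ) (hw : w ≤ j) (hj : j ≤ j') :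
    ageClass ℓ (j - w) j ≤ ageClass ℓ (j' - w) j' := by
  induction hj with
  | refl => exact le_rfl
  | @step j'' h ih =>
    have h' : j ≤ j'' := h
    refine ih.trans ?_
    rw [Nat.succ_eq_add_one, Nat.sub_add_comm (by omega)]
    exact ageClass_le_succ hℓ _ _

lemma mod_succ_of_ne {j m : ℕ} (h : (j + 1) % m ≠ 0) : (j + 1) % m = j % m + 1 := by
  rcases Nat.lt_or_ge 1 m with hm | hm
  · rw [Nat.add_mod_eq_ite, Nat.mod_eq_of_lt hm] at h ⊢
    split_ifs at h ⊢ with h1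
    · have := Nat.mod_lt j (by omega : 0 < m)
      omega
    · rfl
  · interval_cases m <;> simp_all [Nat.mod_one]

/-- The attenuation level goes up by at most one from step to step: when the class changes, the
clock has just reached a multiple of the new period. -/
lemma level_succ_le {ℓ : ℕ} (hℓ : 1 ≤ ℓ) (x j : ℕ) :
    (j + 1) % period (ageClass ℓ (x + 1) (j + 1)) ≤ j % period (ageClass ℓ x j) + 1 := by
  rcases (ageClass_le_succ hℓ x j).lt_or_eq with h | h
  · have h1 := ageClass_spec (ℓ := ℓ) (x := x + 1) (j := j + 1) (by omega)
    by_contra hcon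
    have h2 := mod_succ_of_ne (j := j) (m := period (ageClass ℓ (x + 1) (j + 1))) (by omega)
    have := le_ageClass (ℓ := ℓ) (x := x) (j := j) (i := ageClass ℓ (x + 1) (j + 1)) hℓ (by omega)
    omega
  · rw [← h]
    by_cases h0 : (j + 1) % period (ageClass ℓ x j) = 0
    · omega
    · rw [mod_succ_of_ne h0]

lemma levelProb_nonneg (ℓ x i e : ℕ) : 0 ≤ levelProb ℓ x i e := by
  unfold levelProb; positivity

lemma levelProb_le_half (ℓ x i e : ℕ) : levelProb ℓ x i e ≤ 1 / 2 := min_le_left _ _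

lemma stepProb_nonneg (ℓ w j : ℕ) : 0 ≤ stepProb ℓ w j := by
  unfold stepProb
  split_ifs
  · exact levelProb_nonneg ..
  · exact le_rfl

lemma stepProb_le_half (ℓ w j : ℕ) : stepProb ℓ w j ≤ 1 / 2 := by
  unfold stepProb
  split_ifs
  · exact levelProb_le_half ..
  · norm_num

/-- Transmission probabilities drop at most by the factor `4` from step to step: the attenuation
level and the age each account for a factor of at most `2`. -/
lemma stepProb_le_four_mul_succ {ℓ : ℕ} (hℓ : 1 ≤ ℓ) (w j : ℕ) :
    stepProb ℓ w j ≤ 4 * stepProb ℓ w (j + 1) := by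
  by_cases hw : w ≤ j
  swap
  · rw [stepProb, if_neg hw]
    linarith [stepProb_nonneg ℓ w (j + 1)]
  rw [stepProb, stepProb, if_pos hw, if_pos (by omega), Nat.sub_add_comm hw]
  set x := j - w
  have h1 := level_succ_le hℓ x j
  have h2 := period_mono (ageClass_le_succ hℓ x j)
  set m := period (ageClass ℓ x j)
  set m' := period (ageClass ℓ (x + 1) (j + 1))
  set e := j % m
  set e' := (j + 1) % m'
  unfold levelProb
  have hℓ' : (1 : ℝ) ≤ ℓ := by exact_mod_cast hℓ
  have h2' : (m : ℝ) ≤ m' := by exact_mod_cast h2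
  have h3 : (2 : ℝ) ^ e' ≤ 2 * 2 ^ e := by
    rw [← pow_succ']
    exact pow_le_pow_right₀ one_le_two h1
  change min (1 / 2) ((amplitude * m * ℓ : ℝ) / ((x + ℓ) * 2 ^ e)) ≤
    4 * min (1 / 2) ((amplitude * m' * ℓ : ℝ) / (((x + 1 : ℕ) + ℓ) * 2 ^ e'))
  rw [mul_min_of_nonneg _ _ (by norm_num)]
  refine min_le_min (by norm_num) ?_
  rw [← mul_div_assoc, div_le_div_iff₀ (by positivity) (by positivity)]
  push_cast
  have h4 : ((x : ℝ) + 1 + ℓ) * 2 ^ e' ≤ (2 * (x + ℓ)) * (2 * 2 ^ e) := by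
    gcongr
    linarith
  calc (amplitude * m * ℓ : ℝ) * ((x + 1 + ℓ) * 2 ^ e')
      ≤ (amplitude * m' * ℓ : ℝ) * ((2 * (x + ℓ)) * (2 * 2 ^ e)) := by gcongr
    _ = _ := by ring

/-- The tiles of a block: a node whose class stays at most `I` during an aligned block of length
`period I` returns to level `0` often enough, counted with its period. -/
lemma period_le_sum_period {ℓ w I n : ℕ} (hℓ : 1 ≤ ℓ) (hw : w ≤ period I * n)
    (hI : ∀ j ∈ Finset.Ico (period I * n) (period I * n + period I), ageClass ℓ (j - w) j ≤ I) :
    period I ≤ ∑ j ∈ (Finset.Ico (period I * n) (period I * n + period I)).filter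
      (fun j => j % period (ageClass ℓ (j - w) j) = 0), period (ageClass ℓ (j - w) j) := by
  set b := period I * n with hb
  set S := Finset.Ico b (b + period I) with hS
  set c : ℕ → ℕ := fun j => ageClass ℓ (j - w) j with hc
  -- Each step `j` is sent to the preceding step at which its node was at level `0`.
  have hstart : ∀ j ∈ S, b ≤ j - j % period (c j) ∧ c (j - j % period (c j)) = c j := by
    intro j hj
    obtain ⟨hj1, hj2⟩ := Finset.mem_Ico.mp hj
    have hbj : b ≤ j - j % period (c j) := by
      have hdvd : period (c j) ∣ b := (period_dvd (hI j hj)).mul_right n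
      have h1 : j % period (c j) = (j - b) % period (c j) := by
        have h2 : ((j - b) + b) % period (c j) = (j - b) % period (c j) := by
          rw [Nat.add_mod, Nat.mod_eq_zero_of_dvd hdvd, add_zero, Nat.mod_mod]
        rwa [Nat.sub_add_cancel hj1] at h2
      have := Nat.mod_le (j - b) (period (c j))
      omega
    refine ⟨hbj, le_antisymm (ageClass_mono hℓ (by omega) (Nat.sub_le _ _)) ?_⟩
    rcases Nat.eq_zero_or_pos (c j) with h | h
    · omega
    · have h1 : ℓ * threshold (c j) + j % period (c j) ≤ j - w := ageClass_spec h
      refine le_ageClass hℓ ?_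
      have h2 : (j - j % period (c j)) % period (c j) = 0 :=
        Nat.mod_eq_zero_of_dvd (Nat.dvd_sub_mod j)
      omega
  have hmaps : ∀ j ∈ S, j - j % period (c j) ∈ S.filter (fun j => j % period (c j) = 0) := by
    intro j hj
    obtain ⟨h1, h2⟩ := hstart j hj
    obtain ⟨hj1, hj2⟩ := Finset.mem_Ico.mp hj
    rw [Finset.mem_filter, hS, Finset.mem_Ico, h2]
    exact ⟨⟨h1, by omega⟩, Nat.mod_eq_zero_of_dvd (Nat.dvd_sub_mod j)⟩
  have hcard := Finset.card_eq_sum_card_fiberwise (f := fun j => j - j % period (c j)) hmaps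
  have hSc : S.card = period I := by simp [hS]
  rw [← hSc, hcard]
  refine Finset.sum_le_sum fun a _ => ?_
  calc _ ≤ (Finset.Ico a (a + period (c a))).card := by
        refine Finset.card_le_card fun j hj => ?_
        obtain ⟨hj, hja⟩ := Finset.mem_filter.mp hj
        have h2 := (hstart j hj).2
        rw [hja] at h2
        have := Nat.mod_lt j (period_pos (c j))
        have := Nat.mod_le j (period (c j))
        rw [Finset.mem_Ico, h2]
        omega
    _ = period (c a) := by simp

/-- A logarithmic bound for a harmonic sum. -/
lemma sum_div_add_le {ℓ : ℕ} (hℓ : 1 ≤ ℓ) (a : ℕ) :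
    ∑ x ∈ Finset.range (ℓ * (2 ^ a - 1)), (ℓ : ℝ) / (x + ℓ) ≤ ℓ * a := by
  have hℓ' : (1 : ℝ) ≤ ℓ := by exact_mod_cast hℓ
  induction a with
  | zero => simp
  | succ a ih =>
    have hone : 1 ≤ 2 ^ a := Nat.one_le_two_pow
    have hle : ℓ * (2 ^ a - 1) ≤ ℓ * (2 ^ (a + 1) - 1) :=
      Nat.mul_le_mul_left _ (Nat.sub_le_sub_right (Nat.pow_le_pow_right two_pos (by omega)) 1)
    rw [← Finset.sum_range_add_sum_Ico _ hle]
    have hnew : ∑ x ∈ Finset.Ico (ℓ * (2 ^ a - 1)) (ℓ * (2 ^ (a + 1) - 1)), (ℓ : ℝ) / (x + ℓ) ≤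
        (Finset.Ico (ℓ * (2 ^ a - 1)) (ℓ * (2 ^ (a + 1) - 1))).card • ((1 : ℝ) / 2 ^ a) := by
      refine Finset.sum_le_card_nsmul _ _ _ fun x hx => ?_
      have h1 := (Finset.mem_Ico.mp hx).1
      have h2 : ((ℓ * (2 ^ a - 1) : ℕ) : ℝ) ≤ x := by exact_mod_cast h1
      push_cast [Nat.cast_sub hone] at h2
      rw [div_le_div_iff₀ (by positivity) (by positivity)]
      linarith
    have hcard : (Finset.Ico (ℓ * (2 ^ a - 1)) (ℓ * (2 ^ (a + 1) - 1))).card = ℓ * 2 ^ a := by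
      rw [Nat.card_Ico, ← Nat.mul_sub, pow_succ]
      congr 1
      omega
    rw [hcard, nsmul_eq_mul] at hnew
    have : ((ℓ * 2 ^ a : ℕ) : ℝ) * (1 / 2 ^ a) = ℓ := by
      push_cast
      field_simp
    push_cast
    linarith

lemma two_mul_le_two_pow {u : ℕ} (hu : 1 ≤ u) : 2 * u ≤ 2 ^ u := by
  induction u, hu using Nat.le_induction with
  | base => norm_num
  | succ u hu ih => rw [pow_succ]; omega

/-- The load at the last level of class `i`, where the ages range over `2 ^ 2 ^ (i + 1) + 1` dyadic
scales, is summable over `i`. -/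
lemma lastLevel_coeff_le (i : ℕ) :
    (period i : ℝ) / 2 ^ (period i - 1) * ((2 ^ 2 ^ (i + 1) + 1 : ℕ) : ℝ) ≤ 4 * (1 / 2) ^ i := by
  have h1 : period i = 4 * 2 ^ i := by unfold period; ring
  have hu : 1 ≤ 2 ^ i := Nat.one_le_two_pow
  have h2 := two_mul_le_two_pow hu
  have h3 : (2 : ℝ) ^ 2 ^ (i + 1) = (2 ^ 2 ^ i) ^ 2 := by rw [← pow_mul, pow_succ]
  have h4 : (2 : ℝ) ^ (period i - 1) * 2 = (2 ^ 2 ^ i) ^ 4 := by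
    rw [← pow_succ, ← pow_mul, h1]
    congr 1
    omega
  have h5 : ((1 : ℝ) / 2) ^ i = 1 / 2 ^ i := by rw [div_pow, one_pow]
  have h6 : (2 : ℝ) * 2 ^ i ≤ 2 ^ 2 ^ i := by exact_mod_cast h2
  have h7 : (1 : ℝ) ≤ 2 ^ i := by exact_mod_cast hu
  rw [h5, h1]
  push_cast
  rw [h3]
  have h8 : (2 : ℝ) ^ (4 * 2 ^ i - 1) = (2 ^ 2 ^ i) ^ 4 / 2 := by
    rw [← h1]; linarith
  rw [h8]
  set u : ℝ := 2 ^ i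
  set z : ℝ := 2 ^ 2 ^ i
  have hz : 2 ≤ z := by linarith
  rw [div_mul_eq_mul_div, mul_one_div, div_le_div_iff₀ (by positivity) (by positivity)]
  have h9 : z ^ 2 + 1 ≤ 2 * z ^ 2 := by nlinarith
  have h10 : (2 * u) ^ 2 ≤ z ^ 2 := by gcongr
  calc 4 * u * (z ^ 2 + 1) * u = (4 * u ^ 2) * (z ^ 2 + 1) := by ring
    _ ≤ z ^ 2 * (2 * z ^ 2) := by
        gcongr
        linarith
    _ = 4 * (z ^ 4 / 2) := by ring

/-- Over the whole life of a node, the steps which it spends at the last level of its class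
contribute only a multiple of its weight to the load. -/
lemma sum_stepProb_lastLevel_le {ℓ : ℕ} (hℓ : 1 ≤ ℓ) (w I : ℕ) (J : Finset ℕ)
    (hJ : ∀ j ∈ J, w ≤ j ∧ ageClass ℓ (j - w) j ≤ I ∧
      j % period (ageClass ℓ (j - w) j) = period (ageClass ℓ (j - w) j) - 1) :
    ∑ j ∈ J, stepProb ℓ w j ≤ 8 * amplitude * ℓ := by
  have hℓ' : (1 : ℝ) ≤ ℓ := by exact_mod_cast hℓ
  rw [← Finset.sum_fiberwise_of_maps_to (t := Finset.range (I + 1))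
    (g := fun j => ageClass ℓ (j - w) j)
    (fun j hj => Finset.mem_range.mpr (Nat.lt_succ_of_le (hJ j hj).2.1))]
  have hclass : ∀ i ∈ Finset.range (I + 1),
      ∑ j ∈ J with ageClass ℓ (j - w) j = i, stepProb ℓ w j ≤
        amplitude * ℓ * (4 * (1 / 2) ^ i) := by
    intro i _
    set a := 2 ^ 2 ^ (i + 1) + 1 with ha
    have hage : ∀ j ∈ J.filter (fun j => ageClass ℓ (j - w) j = i),
        j - w < ℓ * (2 ^ a - 1) := by
      intro j hj
      obtain ⟨hj, hji⟩ := Finset.mem_filter.mp hj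
      by_contra hcon
      have hT : period (i + 1) ≤ threshold (i + 1) := period_le_threshold (by omega)
      have hmod := Nat.mod_lt j (period_pos (i + 1))
      have h2a : 2 ^ a = 2 * threshold (i + 1) := by
        rw [ha, pow_succ', threshold]
      have hge : ℓ * (2 * threshold (i + 1) - 1) ≤ j - w := by
        rw [← h2a]; omega
      have hsplit : 2 * threshold (i + 1) - 1 = threshold (i + 1) + (threshold (i + 1) - 1) := by
        have := lt_threshold (i + 1); omega
      rw [hsplit, mul_add] at hge
      have hle : threshold (i + 1) - 1 ≤ ℓ * (threshold (i + 1) - 1) :=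
        Nat.le_mul_of_pos_left _ hℓ
      have := le_ageClass (x := j - w) (j := j) (i := i + 1) hℓ (by omega)
      omega
    calc ∑ j ∈ J with ageClass ℓ (j - w) j = i, stepProb ℓ w j
        ≤ ∑ j ∈ J with ageClass ℓ (j - w) j = i,
            amplitude * (period i / 2 ^ (period i - 1)) * ((ℓ : ℝ) / ((j - w : ℕ) + ℓ)) := by
          refine Finset.sum_le_sum fun j hj => ?_
          obtain ⟨hj, hji⟩ := Finset.mem_filter.mp hj
          obtain ⟨h1, -, h3⟩ := hJ j hj
          rw [stepProb, if_pos h1, h3, hji]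
          refine (min_le_right _ _).trans (le_of_eq ?_)
          field_simp
      _ = amplitude * (period i / 2 ^ (period i - 1)) *
            ∑ x ∈ (J.filter (fun j => ageClass ℓ (j - w) j = i)).image (fun j => j - w),
              ((ℓ : ℝ) / (x + ℓ)) := by
          rw [← Finset.mul_sum, Finset.sum_image]
          intro j hj j' hj' hjj'
          have h1 := (hJ j (Finset.mem_filter.mp hj).1).1
          have h2 := (hJ j' (Finset.mem_filter.mp hj').1).1
          simp only at hjj'
          omega
      _ ≤ amplitude * (period i / 2 ^ (period i - 1)) * (ℓ * a) := by
          gcongr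
          refine (Finset.sum_le_sum_of_subset_of_nonneg ?_ fun _ _ _ => by positivity).trans
            (sum_div_add_le hℓ a)
          intro x hx
          obtain ⟨j, hj, rfl⟩ := Finset.mem_image.mp hx
          exact Finset.mem_range.mpr (hage j hj)
      _ = amplitude * ℓ * (period i / 2 ^ (period i - 1) * a) := by ring
      _ ≤ _ := mul_le_mul_of_nonneg_left (lastLevel_coeff_le i) (by positivity)
  refine (Finset.sum_le_sum hclass).trans ?_
  rw [← Finset.mul_sum, ← Finset.mul_sum]
  have hgeom : ∑ i ∈ Finset.range (I + 1), ((1 : ℝ) / 2) ^ i ≤ 2 := by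
    simpa using sum_geometric_two_le (I + 1)
  calc (amplitude * ℓ : ℝ) * (4 * ∑ i ∈ Finset.range (I + 1), ((1 : ℝ) / 2) ^ i)
      ≤ amplitude * ℓ * (4 * 2) := by gcongr
    _ = _ := by ring

/-! ### Steps in which a single node is likely to transmit -/

/-- The probability that exactly one of independent events, indexed by `K` and with probabilities
`p`, occurs. -/
noncomputable def exactlyOneProb {α : Type*} [DecidableEq α] (K : Finset α) (p : α → ℝ) : ℝ :=
  ∑ v ∈ K, p v * ∏ u ∈ K.erase v, (1 - p u)

lemma exp_neg_two_mul_le {x : ℝ} (h0 : 0 ≤ x) (h1 : x ≤ 1 / 2) : Real.exp (-(2 * x)) ≤ 1 - x := by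
  have hpos : 0 < 1 - x := by linarith
  rw [Real.exp_neg, inv_le_comm₀ (Real.exp_pos _) hpos]
  refine le_trans ?_ (Real.add_one_le_exp _)
  rw [inv_le_iff_one_le_mul₀ hpos]
  nlinarith

lemma le_exactlyOneProb {α : Type*} [DecidableEq α] (K : Finset α) (p : α → ℝ)
    (h0 : ∀ v ∈ K, 0 ≤ p v) (h1 : ∀ v ∈ K, p v ≤ 1 / 2) :
    (∑ v ∈ K, p v) * Real.exp (-(2 * ∑ v ∈ K, p v)) ≤ exactlyOneProb K p := by
  rw [exactlyOneProb, Finset.sum_mul]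
  refine Finset.sum_le_sum fun v hv => mul_le_mul_of_nonneg_left ?_ (h0 v hv)
  rw [Finset.mul_sum, ← Finset.sum_neg_distrib, Real.exp_sum]
  calc ∏ u ∈ K, Real.exp (-(2 * p u)) ≤ ∏ u ∈ K.erase v, Real.exp (-(2 * p u)) := by
        rw [← Finset.mul_prod_erase K _ hv]
        refine mul_le_of_le_one_left (Finset.prod_nonneg fun _ _ => (Real.exp_pos _).le) ?_
        rw [Real.exp_le_one_iff]
        linarith [h0 v hv]
    _ ≤ _ := Finset.prod_le_prod (fun _ _ => (Real.exp_pos _).le) fun u hu =>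
        exp_neg_two_mul_le (h0 u (Finset.mem_of_mem_erase hu)) (h1 u (Finset.mem_of_mem_erase hu))

lemma exactlyOneProb_nonneg {α : Type*} [DecidableEq α] (K : Finset α) (p : α → ℝ)
    (h0 : ∀ v ∈ K, 0 ≤ p v) (h1 : ∀ v ∈ K, p v ≤ 1 / 2) : 0 ≤ exactlyOneProb K p :=
  (mul_nonneg (Finset.sum_nonneg h0) (Real.exp_pos _).le).trans (le_exactlyOneProb K p h0 h1)

/-- The expected number of transmitting nodes of `K` in time-step `j`. -/
noncomputable def load (K : Finset ℕ) (ω : ℕ → ℕ) (j : ℕ) : ℝ :=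
  ∑ v ∈ K, stepProb (weight v) (ω v) j

/-- The probability that exactly one node of `K` transmits in time-step `j`. -/
noncomputable def soloProb (K : Finset ℕ) (ω : ℕ → ℕ) (j : ℕ) : ℝ :=
  exactlyOneProb K fun v => stepProb (weight v) (ω v) j

lemma load_nonneg (K : Finset ℕ) (ω : ℕ → ℕ) (j : ℕ) : 0 ≤ load K ω j :=
  Finset.sum_nonneg fun _ _ => stepProb_nonneg ..

lemma soloProb_nonneg (K : Finset ℕ) (ω : ℕ → ℕ) (j : ℕ) : 0 ≤ soloProb K ω j :=
  exactlyOneProb_nonneg K _ (fun _ _ => stepProb_nonneg ..) fun _ _ => stepProb_le_half ..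

lemma load_mul_exp_le_soloProb (K : Finset ℕ) (ω : ℕ → ℕ) (j : ℕ) :
    load K ω j * Real.exp (-(2 * load K ω j)) ≤ soloProb K ω j :=
  le_exactlyOneProb K _ (fun _ _ => stepProb_nonneg ..) fun _ _ => stepProb_le_half ..

lemma load_le_four_mul_succ (K : Finset ℕ) (ω : ℕ → ℕ) (j : ℕ) :
    load K ω j ≤ 4 * load K ω (j + 1) := by
  rw [load, load, Finset.mul_sum]
  exact Finset.sum_le_sum fun v _ => stepProb_le_four_mul_succ (weight_pos v) _ _

/-- A block with load at least `1/2` somewhere, but not in its last step, contains a step of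
constant success probability: the last one with load at least `1/2`. -/
lemma sum_soloProb_of_heavy {K : Finset ℕ} {ω : ℕ → ℕ} {b m : ℕ}
    (hheavy : ∃ j ∈ Finset.Ico b (b + m), 1 / 2 ≤ load K ω j)
    (hend : load K ω (b + m - 1) < 1 / 2) :
    1 / 4096 ≤ ∑ j ∈ Finset.Ico b (b + m), soloProb K ω j := by
  set S := (Finset.Ico b (b + m)).filter fun j => 1 / 2 ≤ load K ω j with hS
  have hne : S.Nonempty := by
    obtain ⟨j, hj, hj'⟩ := hheavy
    exact ⟨j, Finset.mem_filter.mpr ⟨hj, hj'⟩⟩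
  obtain ⟨hmem, hhalf⟩ := Finset.mem_filter.mp (S.max'_mem hne)
  set j := S.max' hne
  obtain ⟨h1, h2⟩ := Finset.mem_Ico.mp hmem
  have hj : j ≠ b + m - 1 := by
    intro h
    rw [h] at hhalf
    linarith
  have hnext : load K ω (j + 1) < 1 / 2 := by
    by_contra hcon
    have := S.le_max' (j + 1) (Finset.mem_filter.mpr
      ⟨Finset.mem_Ico.mpr ⟨by omega, by omega⟩, not_lt.mp hcon⟩)
    change j + 1 ≤ j at this
    omega
  have hlt := load_le_four_mul_succ K ω j
  have hexp : (1 : ℝ) / 64 ≤ Real.exp (-(2 * load K ω j)) := by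
    have h3 : Real.exp 4 ≤ 64 := by
      have h4 : Real.exp 4 = Real.exp 1 ^ 4 := by rw [← Real.exp_nat_mul]; norm_num
      rw [h4]
      calc Real.exp 1 ^ 4 ≤ 2.8 ^ 4 := by
            gcongr
            linarith [Real.exp_one_lt_d9]
        _ ≤ 64 := by norm_num
    calc (1 : ℝ) / 64 ≤ (Real.exp 4)⁻¹ := by
          rw [one_div]
          exact inv_anti₀ (Real.exp_pos _) h3
      _ = Real.exp (-4) := (Real.exp_neg 4).symm
      _ ≤ _ := Real.exp_le_exp.mpr (by linarith)
  have hsolo := load_mul_exp_le_soloProb K ω j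
  have hsingle := Finset.single_le_sum (f := fun j => soloProb K ω j)
    (fun j _ => soloProb_nonneg K ω j) hmem
  have : (1 : ℝ) / 2 * (1 / 64) ≤ load K ω j * Real.exp (-(2 * load K ω j)) := by gcongr
  linarith

/-- In a block without load `1/2`, a node whose class stays at most `I` adds its share to the
load. -/
lemma sum_stepProb_of_light {ℓ w I n s : ℕ} (hℓ : 1 ≤ ℓ) (hsw : s ≤ w) (hw : w ≤ period I * n)
    (hs : s + period I ≤ period I * n)
    (hI : ∀ j ∈ Finset.Ico (period I * n) (period I * n + period I), ageClass ℓ (j - w) j ≤ I)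
    (hlight : ∀ j ∈ Finset.Ico (period I * n) (period I * n + period I), stepProb ℓ w j < 1 / 2) :
    (amplitude * period I * ℓ : ℝ) / (4 * (period I * n - s : ℕ)) ≤
      ∑ j ∈ Finset.Ico (period I * n) (period I * n + period I), stepProb ℓ w j := by
  set S := Finset.Ico (period I * n) (period I * n + period I) with hS
  set d := period I * n - s with hd
  have hdpos : 0 < d := by have := period_pos I; omega
  have hℓ' : (1 : ℝ) ≤ ℓ := by exact_mod_cast hℓ
  have htile := period_le_sum_period hℓ hw hI
  set Z := S.filter (fun j => j % period (ageClass ℓ (j - w) j) = 0) with hZ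
  have hterm : ∀ j ∈ Z, (period (ageClass ℓ (j - w) j) : ℝ) * (amplitude * ℓ / (4 * d)) ≤
      stepProb ℓ w j := by
    intro j hj
    obtain ⟨hjS, hj0⟩ := Finset.mem_filter.mp hj
    obtain ⟨h1, h2⟩ := Finset.mem_Ico.mp hjS
    have hlt := hlight j hjS
    rw [stepProb, if_pos (by omega), hj0, levelProb, pow_zero, mul_one] at hlt ⊢
    set m := period (ageClass ℓ (j - w) j)
    have hm : (1 : ℝ) ≤ m := by exact_mod_cast period_pos _
    have hamp : (2 : ℝ) ^ 15 = amplitude := by norm_num [amplitude]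
    have hx : ((j - w : ℕ) : ℝ) ≤ 2 * d := by
      have : j - w ≤ 2 * d := by omega
      exact_mod_cast this
    rcases min_lt_iff.mp hlt with h | h
    · exact absurd h (lt_irrefl _)
    rw [min_eq_right h.le]
    -- The cap `1/2` is not reached, which forces the age to exceed the weight.
    have hage : (ℓ : ℝ) ≤ (j - w : ℕ) := by
      rw [div_lt_iff₀ (by positivity)] at h
      have : (4 : ℝ) * ℓ ≤ amplitude * m * ℓ := by
        have h4 : (4 : ℝ) ≤ amplitude * m := by rw [← hamp]; linarith
        gcongr
      linarith
    rw [← mul_div_assoc, div_le_div_iff₀ (by positivity) (by positivity)]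
    calc (m : ℝ) * (amplitude * ℓ) * ((j - w : ℕ) + ℓ)
        ≤ (m : ℝ) * (amplitude * ℓ) * (4 * d) := by
          gcongr
          linarith
      _ = _ := by ring
  calc (amplitude * period I * ℓ : ℝ) / (4 * d) = period I * (amplitude * ℓ / (4 * d)) := by ring
    _ ≤ ((∑ j ∈ Z, period (ageClass ℓ (j - w) j) : ℕ) : ℝ) * (amplitude * ℓ / (4 * d)) := by
        gcongr
    _ = ∑ j ∈ Z, (period (ageClass ℓ (j - w) j) : ℝ) * (amplitude * ℓ / (4 * d)) := by
        rw [Nat.cast_sum, Finset.sum_mul]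
    _ ≤ ∑ j ∈ Z, stepProb ℓ w j := Finset.sum_le_sum hterm
    _ ≤ _ := Finset.sum_le_sum_of_subset_of_nonneg (Finset.filter_subset _ _)
        fun _ _ _ => stepProb_nonneg ..

/-- A block without load `1/2` in which enough weight is awake. Nodes of class above `I` are so old
that their weights may be neglected. -/
lemma sum_soloProb_of_light {K : Finset ℕ} {ω : ℕ → ℕ} {s I n : ℕ} (hs : ∀ v ∈ K, s ≤ ω v)
    (hsn : s + period I ≤ period I * n)
    (hlight : ∀ j ∈ Finset.Ico (period I * n) (period I * n + period I), load K ω j < 1 / 2)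
    (hW : period I * n - s ≤ delayConst * 2 ^ I * ∑ v ∈ K with ω v ≤ period I * n, weight v)
    (hY : 4 * K.card * delayConst * 2 ^ I ≤ threshold (I + 1)) :
    1 / 4096 ≤ ∑ j ∈ Finset.Ico (period I * n) (period I * n + period I), soloProb K ω j := by
  classical
  set b := period I * n with hb
  set S := Finset.Ico b (b + period I) with hS
  set d := b - s with hd
  have hdpos : 0 < d := by have := period_pos I; omega
  set P := K.filter fun v => ω v ≤ b with hP
  set G := P.filter fun v => ∀ j ∈ S, ageClass (weight v) (j - ω v) j ≤ I with hG
  set G' := P.filter fun v => ¬ ∀ j ∈ S, ageClass (weight v) (j - ω v) j ≤ I with hG'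
  have hold : ∀ v ∈ G', weight v * threshold (I + 1) ≤ 2 * d := by
    intro v hv
    obtain ⟨hvP, hv2⟩ := Finset.mem_filter.mp hv
    obtain ⟨hvK, hvb⟩ := Finset.mem_filter.mp hvP
    push Not at hv2
    obtain ⟨j, hj, hcls⟩ := hv2
    have h1 := ageClass_spec (ℓ := weight v) (x := j - ω v) (j := j) (by omega)
    have h2 : weight v * threshold (I + 1) ≤
        weight v * threshold (ageClass (weight v) (j - ω v) j) :=
      Nat.mul_le_mul_left _ (threshold_mono hcls)
    have h3 := hs v hvK
    have h4 := (Finset.mem_Ico.mp hj).2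
    omega
  have hsplit : ∑ v ∈ P, weight v = ∑ v ∈ G, weight v + ∑ v ∈ G', weight v :=
    (Finset.sum_filter_add_sum_filter_not P _ _).symm
  have hGW : d ≤ 2 * (delayConst * 2 ^ I) * ∑ v ∈ G, weight v := by
    have h1 : (∑ v ∈ G', weight v) * threshold (I + 1) ≤ K.card * (2 * d) := by
      rw [Finset.sum_mul]
      refine (Finset.sum_le_card_nsmul _ _ _ hold).trans ?_
      rw [smul_eq_mul]
      exact Nat.mul_le_mul_right _ (Finset.card_le_card
        ((Finset.filter_subset _ _).trans (Finset.filter_subset _ _)))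
    have h2 : 2 * (delayConst * 2 ^ I) * ∑ v ∈ G', weight v ≤ d := by
      rcases Nat.eq_zero_or_pos K.card with h0 | h0
      · have hKe : K = ∅ := Finset.card_eq_zero.mp h0
        have : G' = ∅ := by simp [hG', hP, hKe]
        simp [this]
      · refine le_of_mul_le_mul_left ?_ (by omega : 0 < 2 * K.card)
        calc 2 * K.card * (2 * (delayConst * 2 ^ I) * ∑ v ∈ G', weight v)
            = (∑ v ∈ G', weight v) * (4 * K.card * delayConst * 2 ^ I) := by ring
          _ ≤ (∑ v ∈ G', weight v) * threshold (I + 1) := Nat.mul_le_mul_left _ hY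
          _ ≤ K.card * (2 * d) := h1
          _ = 2 * K.card * d := by ring
    rw [hsplit, mul_add] at hW
    linarith
  have hload : (1 : ℝ) / 1024 ≤ ∑ j ∈ S, load K ω j := by
    calc (1 : ℝ) / 1024
        ≤ ∑ v ∈ G, (amplitude * period I * weight v : ℝ) / (4 * d) := by
          rw [← Finset.sum_div, ← Finset.mul_sum, ← Nat.cast_sum,
            div_le_div_iff₀ (by norm_num) (by positivity)]
          have h1 : (d : ℝ) ≤ 2 * (delayConst * 2 ^ I) * (∑ v ∈ G, weight v : ℕ) := by
            exact_mod_cast hGW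
          have h2 : (delayConst : ℝ) = 512 * amplitude := by norm_num [delayConst, amplitude]
          have h3 : (period I : ℝ) = 4 * 2 ^ I := by unfold period; push_cast; ring
          rw [h2] at h1
          rw [h3]
          linarith
      _ ≤ ∑ v ∈ G, ∑ j ∈ S, stepProb (weight v) (ω v) j := by
          refine Finset.sum_le_sum fun v hv => ?_
          obtain ⟨hvP, hv2⟩ := Finset.mem_filter.mp hv
          obtain ⟨hvK, hvb⟩ := Finset.mem_filter.mp hvP
          refine sum_stepProb_of_light (weight_pos v) (hs v hvK) hvb hsn hv2 fun j hj => ?_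
          exact (Finset.single_le_sum (f := fun v => stepProb (weight v) (ω v) j)
            (fun _ _ => stepProb_nonneg ..) hvK).trans_lt (hlight j hj)
      _ ≤ ∑ v ∈ K, ∑ j ∈ S, stepProb (weight v) (ω v) j :=
          Finset.sum_le_sum_of_subset_of_nonneg
            ((Finset.filter_subset _ _).trans (Finset.filter_subset _ _))
            fun _ _ _ => Finset.sum_nonneg fun _ _ => stepProb_nonneg ..
      _ = ∑ j ∈ S, load K ω j := Finset.sum_comm
  have hexp : (1 : ℝ) / 4 ≤ Real.exp (-1) := by
    rw [Real.exp_neg, one_div]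
    exact inv_anti₀ (Real.exp_pos _) (by linarith [Real.exp_one_lt_d9])
  calc (1 : ℝ) / 4096 = 1 / 1024 * (1 / 4) := by norm_num
    _ ≤ (∑ j ∈ S, load K ω j) * (1 / 4) := by gcongr
    _ = ∑ j ∈ S, load K ω j * (1 / 4) := Finset.sum_mul ..
    _ ≤ ∑ j ∈ S, soloProb K ω j := by
        refine Finset.sum_le_sum fun j hj => le_trans ?_ (load_mul_exp_le_soloProb K ω j)
        refine mul_le_mul_of_nonneg_left (hexp.trans ?_) (load_nonneg ..)
        exact Real.exp_le_exp.mpr (by linarith [hlight j hj])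

/-- Nodes of class above `I` transmit with probability at most `1 / (4 k)`, in the form of a bound for
the period. -/
lemma four_mul_period_le_threshold {k I i : ℕ}
    (hY : 4 * k * delayConst * 2 ^ I ≤ threshold (I + 1)) (hi : I + 1 ≤ i) :
    4 * k * amplitude * period i ≤ threshold i := by
  induction i, hi using Nat.le_induction with
  | base =>
    refine le_trans ?_ hY
    have h1 : period (I + 1) = 8 * 2 ^ I := by unfold period; ring
    have h2 : delayConst = 512 * amplitude := by norm_num [delayConst, amplitude]
    rw [h1, h2]
    have := Nat.zero_le (k * amplitude * 2 ^ I)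
    linarith
  | succ i _ ih =>
    rw [period_succ]
    have := two_mul_threshold_le i
    linarith

/-- There are few blocks with load `1/2` in their last step. -/
lemma card_bad_blocks_le {K : Finset ℕ} {ω : ℕ → ℕ} {I : ℕ} {F : Finset ℕ}
    (hF : ∀ n ∈ F, 1 / 2 ≤ load K ω (period I * n + period I - 1))
    (hY : 4 * K.card * delayConst * 2 ^ I ≤ threshold (I + 1)) :
    F.card ≤ 32 * amplitude * ∑ v ∈ K, weight v := by
  classical
  set e : ℕ → ℕ := fun n => period I * n + period I - 1 with he
  have hpos := period_pos I
  set good : ℕ → ℕ → Prop := fun v n =>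
    ω v ≤ e n ∧ ageClass (weight v) (e n - ω v) (e n) ≤ I with hgood
  have hquarter : ∀ n ∈ F,
      (1 : ℝ) / 4 ≤ ∑ v ∈ K with good v n, stepProb (weight v) (ω v) (e n) := by
    intro n hn
    have h1 : (1 : ℝ) / 2 ≤ ∑ v ∈ K, stepProb (weight v) (ω v) (e n) := hF n hn
    rw [← Finset.sum_filter_add_sum_filter_not K (fun v => good v n)] at h1
    have h2 : ∑ v ∈ K with ¬ good v n, stepProb (weight v) (ω v) (e n) ≤ 1 / 4 := by
      have hKpos : K.Nonempty := by
        by_contra hcon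
        rw [Finset.not_nonempty_iff_eq_empty] at hcon
        simp only [hcon, Finset.filter_empty, Finset.sum_empty] at h1
        norm_num at h1
      have hk : (1 : ℝ) ≤ K.card := by exact_mod_cast hKpos.card_pos
      have h3 : ∀ v ∈ K.filter fun v => ¬ good v n, stepProb (weight v) (ω v) (e n) ≤ 1 / (4 * K.card) := by
        intro v hv
        have hv2 := (Finset.mem_filter.mp hv).2
        by_cases hw : ω v ≤ e n
        swap
        · rw [stepProb, if_neg hw]
          positivity
        rw [stepProb, if_pos hw]
        have hcls : I + 1 ≤ ageClass (weight v) (e n - ω v) (e n) := by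
          by_contra hcon
          exact hv2 ⟨hw, by omega⟩
        have h4 := ageClass_spec (ℓ := weight v) (x := e n - ω v) (j := e n) (by omega)
        have h5 := four_mul_period_le_threshold hY hcls
        set i := ageClass (weight v) (e n - ω v) (e n)
        have h6 : (weight v : ℝ) * threshold i ≤ (e n - ω v : ℕ) := by
          have : weight v * threshold i ≤ e n - ω v := by omega
          exact_mod_cast this
        have h7 : (4 * K.card * amplitude * period i : ℝ) ≤ threshold i := by exact_mod_cast h5
        have h8 : (1 : ℝ) ≤ weight v := by exact_mod_cast weight_pos v
        refine (min_le_right _ _).trans ?_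
        rw [div_le_div_iff₀ (by positivity) (by positivity)]
        have h9 : (1 : ℝ) ≤ 2 ^ (e n % period i) := one_le_pow₀ one_le_two
        calc (amplitude * period i * weight v : ℝ) * (4 * K.card)
            = weight v * (4 * K.card * amplitude * period i) := by ring
          _ ≤ weight v * threshold i := by gcongr
          _ ≤ ((e n - ω v : ℕ) + weight v) * 1 := by linarith
          _ ≤ ((e n - ω v : ℕ) + weight v) * 2 ^ (e n % period i) := by gcongr
          _ = _ := by ring
      calc _ ≤ ((K.filter fun v => ¬ good v n).card : ℝ) * (1 / (4 * K.card)) := by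
            rw [← nsmul_eq_mul]
            exact Finset.sum_le_card_nsmul _ _ _ h3
        _ ≤ K.card * (1 / (4 * K.card)) := by
            gcongr
            exact Finset.filter_subset _ _
        _ = 1 / 4 := by field_simp
    linarith
  have hsum : (F.card : ℝ) * (1 / 4) ≤ ∑ v ∈ K, 8 * amplitude * (weight v : ℝ) := by
    calc (F.card : ℝ) * (1 / 4) ≤ ∑ n ∈ F, ∑ v ∈ K with good v n,
          stepProb (weight v) (ω v) (e n) := by
          rw [← nsmul_eq_mul]
          exact Finset.card_nsmul_le_sum _ _ _ hquarter
      _ = ∑ v ∈ K, ∑ n ∈ F with good v n, stepProb (weight v) (ω v) (e n) := by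
          simp_rw [Finset.sum_filter]
          exact Finset.sum_comm
      _ ≤ _ := by
          refine Finset.sum_le_sum fun v _ => ?_
          have hinj : Set.InjOn e (F.filter (good v) : Set ℕ) := by
            intro a _ a' _ haa'
            simp only [he] at haa'
            have : period I * a = period I * a' := by omega
            exact Nat.eq_of_mul_eq_mul_left hpos this
          rw [← Finset.sum_image (f := fun j => stepProb (weight v) (ω v) j) hinj]
          refine sum_stepProb_lastLevel_le (weight_pos v) (ω v) I _ fun j hj => ?_
          obtain ⟨n, hn, rfl⟩ := Finset.mem_image.mp hj
          obtain ⟨hw, hcls⟩ := (Finset.mem_filter.mp hn).2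
          refine ⟨hw, hcls, ?_⟩
          obtain ⟨c, hc⟩ := period_dvd hcls
          set m := period (ageClass (weight v) (e n - ω v) (e n))
          have hm : 0 < m := period_pos _
          have hc1 : 1 ≤ c * (n + 1) := by
            have : 0 < c := Nat.pos_of_ne_zero (by rintro rfl; omega)
            exact Nat.mul_pos this n.succ_pos
          have heq : e n = m * (c * (n + 1) - 1) + (m - 1) := by
            have h1 : e n + 1 = m * (c * (n + 1)) := by
              rw [he, hc]
              have : 0 < m * c := hc ▸ hpos
              simp only
              rw [Nat.sub_add_cancel (by omega)]
              ring
            obtain ⟨y, hy⟩ := Nat.exists_eq_add_of_le' hc1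
            rw [hy] at h1 ⊢
            rw [Nat.add_sub_cancel]
            rw [mul_add, mul_one] at h1
            omega
          rw [heq, Nat.mul_add_mod, Nat.mod_eq_of_lt (by omega)]
  rw [← Finset.mul_sum] at hsum
  have : (F.card : ℝ) ≤ 32 * amplitude * ∑ v ∈ K, (weight v : ℝ) := by linarith
  exact_mod_cast this

lemma sum_Ico_blocks {f : ℕ → ℝ} (m a N : ℕ) :
    ∑ n ∈ Finset.Ico a (a + N), ∑ j ∈ Finset.Ico (m * n) (m * n + m), f j =
      ∑ j ∈ Finset.Ico (m * a) (m * (a + N)), f j := by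
  induction N with
  | zero => simp
  | succ N ih =>
    rw [← add_assoc, Finset.sum_Ico_succ_top (by omega), ih, mul_add m (a + N) 1, mul_one,
      Finset.sum_Ico_consecutive _ (Nat.mul_le_mul_left m (by omega)) (by omega)]

/-- If the weights of the awake nodes have kept pace with the time elapsed, then the expected
number of steps with a single transmitter is at least proportional to the total weight. -/
theorem le_sum_soloProb {K : Finset ℕ} {ω : ℕ → ℕ} {s τ I : ℕ} (hK : K.Nonempty)
    (hs : ∀ v ∈ K, s ≤ ω v)
    (hτ : delayConst * 2 ^ I * ∑ v ∈ K, weight v ≤ τ)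
    (hbefore : ∀ t < τ, t ≤ delayConst * 2 ^ I * ∑ v ∈ K with ω v ≤ s + t, weight v)
    (hY : 4 * K.card * delayConst * 2 ^ I ≤ threshold (I + 1)) :
    256 * ((τ : ℝ) / (delayConst * 2 ^ I)) ≤ ∑ j ∈ Finset.Ico s (s + τ), soloProb K ω j := by
  classical
  set m := period I with hm
  have hmpos : 0 < m := period_pos I
  have hm4 : m = 4 * 2 ^ I := by rw [hm, period]; ring
  set W := ∑ v ∈ K, weight v with hW
  have hWpos : 1 ≤ W := by
    obtain ⟨v, hv⟩ := hK
    exact (weight_pos v).trans (Finset.single_le_sum (fun _ _ => Nat.zero_le _) hv)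
  set a := s / m + 2 with ha
  set N := τ / m - 2 with hN
  have hdm : 128 * amplitude * W ≤ τ / m := by
    rw [Nat.le_div_iff_mul_le hmpos, hm4]
    refine le_trans (le_of_eq ?_) hτ
    have h2 : delayConst = 512 * amplitude := by norm_num [delayConst, amplitude]
    rw [h2]; ring
  have hamp : 8 ≤ amplitude := by norm_num [amplitude]
  have hampW : 8 ≤ amplitude * W := by nlinarith
  have hsm := Nat.div_add_mod s m
  have hsm' := Nat.mod_lt s hmpos
  have hτm := Nat.div_add_mod τ m
  have hτm' := Nat.mod_lt τ hmpos
  have hstart : s + m ≤ m * a := by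
    rw [ha, mul_add]; omega
  have hend : m * (a + N) ≤ s + τ := by
    have : a + N = s / m + τ / m := by
      have : 2 ≤ τ / m := by nlinarith
      omega
    rw [this, mul_add]
    omega
  set bad := (Finset.Ico a (a + N)).filter fun n => 1 / 2 ≤ load K ω (m * n + m - 1) with hbad
  have hbadcard : bad.card ≤ 32 * amplitude * W :=
    card_bad_blocks_le (fun n hn => (Finset.mem_filter.mp hn).2) hY
  set ok := (Finset.Ico a (a + N)).filter fun n => ¬ 1 / 2 ≤ load K ω (m * n + m - 1) with hok
  have hcards : bad.card + ok.card = N := by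
    rw [hbad, hok, Finset.card_filter_add_card_filter_not]
    simp
  have hokcard : N ≤ 2 * ok.card := by
    have : 2 * bad.card ≤ N := by
      have h1 : 128 * amplitude * W - 2 ≤ N := by omega
      have h2 : 64 * (amplitude * W) ≤ 128 * (amplitude * W) - 2 := by omega
      have h3 : 128 * amplitude * W = 128 * (amplitude * W) := by ring
      have h4 : 32 * amplitude * W = 32 * (amplitude * W) := by ring
      omega
    omega
  have hNτ : τ ≤ 2 * (m * N) := by
    have h1 : τ / m + 1 ≤ 2 * N := by
      have : 128 * amplitude * W = 128 * (amplitude * W) := by ring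
      omega
    calc τ ≤ m * (τ / m + 1) := by rw [mul_add]; omega
      _ ≤ m * (2 * N) := Nat.mul_le_mul_left _ h1
      _ = _ := by ring
  have hblock : ∀ n ∈ ok, (1 : ℝ) / 4096 ≤ ∑ j ∈ Finset.Ico (m * n) (m * n + m), soloProb K ω j := by
    intro n hn
    obtain ⟨hn1, hn2⟩ := Finset.mem_filter.mp hn
    obtain ⟨hn3, hn4⟩ := Finset.mem_Ico.mp hn1
    have hsn : s + m ≤ m * n := hstart.trans (Nat.mul_le_mul_left _ hn3)
    by_cases hheavy : ∃ j ∈ Finset.Ico (m * n) (m * n + m), 1 / 2 ≤ load K ω j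
    · exact sum_soloProb_of_heavy hheavy (not_le.mp hn2)
    · push Not at hheavy
      refine sum_soloProb_of_light hs hsn hheavy ?_ hY
      have hlt : m * n - s < τ := by
        have : m * (n + 1) ≤ m * (a + N) := Nat.mul_le_mul_left _ (by omega)
        rw [mul_add, mul_one] at this
        omega
      have := hbefore _ hlt
      rwa [Nat.add_sub_of_le (by omega)] at this
  calc 256 * ((τ : ℝ) / (delayConst * 2 ^ I)) ≤ (ok.card : ℝ) * (1 / 4096) := by
        have h1 : (τ : ℝ) ≤ 2 * (m * N) := by exact_mod_cast hNτ
        have h2 : (N : ℝ) ≤ 2 * ok.card := by exact_mod_cast hokcard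
        have h3 : (m : ℝ) = 4 * 2 ^ I := by exact_mod_cast hm4
        have h4 : (τ : ℝ) ≤ 16 * 2 ^ I * ok.card := by
          calc (τ : ℝ) ≤ 2 * (m * N) := h1
            _ ≤ 2 * (m * (2 * ok.card)) := by gcongr
            _ = _ := by rw [h3]; ring
        rw [← mul_div_assoc, div_le_iff₀ (by norm_num [delayConst])]
        have h5 : (delayConst : ℝ) = 2 ^ 24 := by norm_num [delayConst]
        rw [h5]
        linarith
    _ ≤ ∑ n ∈ ok, ∑ j ∈ Finset.Ico (m * n) (m * n + m), soloProb K ω j := by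
        rw [← nsmul_eq_mul]
        exact Finset.card_nsmul_le_sum _ _ _ hblock
    _ ≤ ∑ n ∈ Finset.Ico a (a + N), ∑ j ∈ Finset.Ico (m * n) (m * n + m), soloProb K ω j :=
        Finset.sum_le_sum_of_subset_of_nonneg (Finset.filter_subset _ _)
          fun _ _ _ => Finset.sum_nonneg fun _ _ => soloProb_nonneg ..
    _ = ∑ j ∈ Finset.Ico (m * a) (m * (a + N)), soloProb K ω j := sum_Ico_blocks ..
    _ ≤ _ := Finset.sum_le_sum_of_subset_of_nonneg
        (Finset.Ico_subset_Ico (by omega) hend) fun _ _ _ => soloProb_nonneg ..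

/-! ### The critical time of an instance -/

/-- The exponent of the number of attenuation levels which `k` nodes need, about
`log₂ log₂ log₂ k`. -/
def scaleIndex (k : ℕ) : ℕ := Nat.clog 2 (Nat.clog 2 (Nat.clog 2 k)) + 2

lemma scaleIndex_mono : Monotone scaleIndex := fun _ _ h =>
  Nat.add_le_add_right (Nat.clog_mono_right 2 (Nat.clog_mono_right 2 (Nat.clog_mono_right 2 h))) 2

lemma clog_two_le_self (n : ℕ) : Nat.clog 2 n ≤ n :=
  Nat.clog_le_of_le_pow Nat.lt_two_pow_self.le

lemma two_pow_clog_le (n : ℕ) : 2 ^ Nat.clog 2 n ≤ 2 * max 1 n := by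
  rcases Nat.lt_or_ge 1 n with h | h
  · have h1 := Nat.pow_pred_clog_lt_self one_lt_two h
    have h2 : 0 < Nat.clog 2 n := Nat.clog_pos one_lt_two h
    obtain ⟨c, hc⟩ := Nat.exists_eq_succ_of_ne_zero h2.ne'
    rw [hc] at h1 ⊢
    simp only [Nat.pred_succ] at h1
    rw [Nat.succ_eq_add_one, pow_succ]
    have := le_max_right 1 n
    omega
  · rw [Nat.clog_of_right_le_one h, pow_zero]
    omega

lemma two_pow_scaleIndex_le (k : ℕ) :
    2 ^ scaleIndex k ≤ 8 * max 1 (Nat.clog 2 (Nat.clog 2 k)) := by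
  rw [scaleIndex, pow_add]
  have := two_pow_clog_le (Nat.clog 2 (Nat.clog 2 k))
  omega

lemma two_pow_scaleIndex_le_mul {k : ℕ} (hk : 1 ≤ k) : 2 ^ scaleIndex k ≤ 8 * k := by
  have h1 := two_pow_scaleIndex_le k
  have h2 := (clog_two_le_self (Nat.clog 2 k)).trans (clog_two_le_self k)
  omega

lemma clog_two_le_logb (n : ℕ) : (Nat.clog 2 n : ℝ) ≤ Real.logb 2 n + 1 := by
  rcases Nat.eq_zero_or_pos n with rfl | hn
  · simp
  have h := Real.natCeil_logb_natCast 2 n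
  rw [← h]
  exact (Nat.ceil_lt_add_one (Real.logb_nonneg one_lt_two (by exact_mod_cast hn))).le

lemma two_pow_scaleIndex_le_logLog (k : ℕ) : (2 : ℝ) ^ scaleIndex k ≤ 24 * logLog k := by
  have h1 : (2 : ℝ) ^ scaleIndex k ≤ 8 * max 1 (Nat.clog 2 (Nat.clog 2 k) : ℝ) := by
    exact_mod_cast two_pow_scaleIndex_le k
  have hL := one_le_logLog k
  have h2 : (Nat.clog 2 (Nat.clog 2 k) : ℝ) ≤ 3 * logLog k := by
    rcases Nat.lt_or_ge k 2 with hk | hk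
    · have : Nat.clog 2 k = 0 := Nat.clog_of_right_le_one (by omega) 2
      rw [this]
      simp
      linarith
    · have hk' : (2 : ℝ) ≤ k := by exact_mod_cast hk
      have h3 : 1 ≤ Real.logb 2 k := by
        rw [Real.le_logb_iff_rpow_le one_lt_two (by linarith)]
        simpa using hk'
      have h4 : (Nat.clog 2 k : ℝ) ≤ 2 * Real.logb 2 k := by linarith [clog_two_le_logb k]
      have h5 : (0 : ℝ) < Nat.clog 2 k := by exact_mod_cast Nat.clog_pos one_lt_two hk
      have h6 : Real.logb 2 (Nat.clog 2 k) ≤ 1 + Real.logb 2 (Real.logb 2 k) := by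
        refine (Real.logb_le_logb_of_le one_lt_two h5 h4).trans (le_of_eq ?_)
        rw [Real.logb_mul (by norm_num) (by linarith), Real.logb_self_eq_one one_lt_two]
      have h7 : Real.logb 2 (Real.logb 2 k) ≤ logLog k := le_max_right _ _
      linarith [clog_two_le_logb (Nat.clog 2 k)]
  have : max 1 (Nat.clog 2 (Nat.clog 2 k) : ℝ) ≤ 3 * logLog k := max_le (by linarith) h2
  linarith

/-- With `2 ^ scaleIndex k` as the scale, nodes of higher class are negligible among `k` nodes. -/
lemma scaleIndex_spec (k : ℕ) :
    4 * k * delayConst * 2 ^ scaleIndex k ≤ threshold (scaleIndex k + 1) := by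
  have h1 : k ≤ 2 ^ Nat.clog 2 k := Nat.le_pow_clog one_lt_two k
  have h2 : Nat.clog 2 k ≤ 2 ^ Nat.clog 2 (Nat.clog 2 k) := Nat.le_pow_clog one_lt_two _
  have h3 : Nat.clog 2 (Nat.clog 2 k) ≤ 2 ^ Nat.clog 2 (Nat.clog 2 (Nat.clog 2 k)) :=
    Nat.le_pow_clog one_lt_two _
  set κ := Nat.clog 2 k
  set c := Nat.clog 2 (Nat.clog 2 κ)
  have hI : scaleIndex k = c + 2 := rfl
  rw [hI]
  set u := 2 ^ (c + 2) with hu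
  have hu4 : u = 4 * 2 ^ c := by rw [hu]; ring
  have hc : 1 ≤ 2 ^ c := Nat.one_le_two_pow
  have hcu : c + 2 < u := Nat.lt_two_pow_self
  have huu : u < 2 ^ u := Nat.lt_two_pow_self
  have h16 : 16 ≤ 2 ^ u := by
    calc 16 = 2 ^ 4 := by norm_num
      _ ≤ 2 ^ u := Nat.pow_le_pow_right two_pos (by omega)
  have hκ : κ ≤ 2 ^ u := h2.trans (Nat.pow_le_pow_right two_pos (by omega))
  have hexp : κ + 26 + (c + 2) ≤ 2 ^ 2 ^ (c + 2 + 1) := by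
    have : 2 ^ (c + 2 + 1) = u + u := by rw [pow_succ, ← hu]; ring
    rw [this, pow_add]
    nlinarith
  calc 4 * k * delayConst * u ≤ 4 * 2 ^ κ * delayConst * u := by gcongr
    _ = 2 ^ (κ + 26 + (c + 2)) := by
        have : delayConst = 2 ^ 24 := rfl
        rw [this, hu]
        ring
    _ ≤ threshold (c + 2 + 1) := Nat.pow_le_pow_right two_pos hexp

/-- `τ` is a critical time for the nodes `K` and a start `s`: all of `K` is awake by then, `τ`
reaches the delay allowed for `K`, but every earlier time was within the delay allowed for the nodes
awake at that time. -/
structure IsCritical (K : Finset ℕ) (ω : ℕ → ℕ) (s τ : ℕ) : Prop where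
  nonempty : K.Nonempty
  pos : ∀ v ∈ K, 1 ≤ v
  le_wake : ∀ v ∈ K, s ≤ ω v
  wake_le : ∀ v ∈ K, ω v ≤ s + τ
  delay_le : delayConst * 2 ^ scaleIndex K.card * ∑ v ∈ K, weight v ≤ τ
  le_delay : ∀ t < τ,
    t ≤ delayConst * 2 ^ scaleIndex K.card * ∑ v ∈ K with ω v ≤ s + t, weight v

/-- Every instance contains a critical one, formed by the nodes awake at the critical time. -/
lemma exists_isCritical {K : Finset ℕ} {ω : ℕ → ℕ} {s : ℕ} (hpos : ∀ v ∈ K, 1 ≤ v)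
    (hs : ∀ v ∈ K, s ≤ ω v) (hs' : ∃ v ∈ K, ω v = s) :
    ∃ τ ≤ delayConst * 2 ^ scaleIndex K.card * ∑ v ∈ K, weight v,
      IsCritical (K.filter fun v => ω v ≤ s + τ) ω s τ := by
  classical
  set g : ℕ → ℕ := fun t => delayConst * 2 ^ scaleIndex (K.filter fun v => ω v ≤ s + t).card *
    ∑ v ∈ K with ω v ≤ s + t, weight v with hg
  set τ₁ := delayConst * 2 ^ scaleIndex K.card * ∑ v ∈ K, weight v with hτ₁
  have h1 : g τ₁ ≤ τ₁ := by
    rw [hg, hτ₁]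
    refine Nat.mul_le_mul (Nat.mul_le_mul_left _ (Nat.pow_le_pow_right two_pos
      (scaleIndex_mono (Finset.card_filter_le _ _)))) ?_
    exact Finset.sum_le_sum_of_subset (Finset.filter_subset _ _)
  have hex : ∃ t, g t ≤ t := ⟨τ₁, h1⟩
  refine ⟨Nat.find hex, Nat.find_min' hex h1, ?_⟩
  have hspec := Nat.find_spec hex
  have hmin := fun t (ht : t < Nat.find hex) => Nat.find_min hex ht
  set τ := Nat.find hex
  refine ⟨?_, fun v hv => hpos v (Finset.mem_filter.mp hv).1,
    fun v hv => hs v (Finset.mem_filter.mp hv).1, fun v hv => (Finset.mem_filter.mp hv).2, hspec,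
    fun t ht => ?_⟩
  · obtain ⟨v, hv, hvs⟩ := hs'
    exact ⟨v, Finset.mem_filter.mpr ⟨hv, by omega⟩⟩
  · refine (not_le.mp (hmin t ht)).le.trans ?_
    rw [hg, Finset.filter_filter]
    have h2 : (K.filter fun v => ω v ≤ s + τ ∧ ω v ≤ s + t) = K.filter fun v => ω v ≤ s + t :=
      Finset.filter_congr fun v _ => ⟨fun h => h.2, fun h => ⟨by omega, h⟩⟩
    rw [h2]
    refine Nat.mul_le_mul_right _ (Nat.mul_le_mul_left _ (Nat.pow_le_pow_right two_pos
      (scaleIndex_mono (Finset.card_le_card fun v hv => ?_))))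
    rw [Finset.mem_filter] at hv ⊢
    exact ⟨hv.1, by omega⟩

lemma sum_Icc_inv_sq_le (N : ℕ) : ∑ v ∈ Finset.Icc 1 N, ((v : ℝ) ^ 2)⁻¹ ≤ 2 := by
  rcases Nat.eq_zero_or_pos N with rfl | hN
  · simp
  have h : ∑ v ∈ Finset.Icc 1 N, ((v : ℝ) ^ 2)⁻¹ ≤ 2 - 1 / N := by
    induction N, hN using Nat.le_induction with
    | base => norm_num
    | succ N hN ih =>
      rw [Finset.sum_Icc_succ_top (by omega)]
      have hN' : (0 : ℝ) < N := by exact_mod_cast hN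
      have h : (((N + 1 : ℕ) : ℝ) ^ 2)⁻¹ ≤ 1 / N - 1 / (N + 1 : ℕ) := by
        push_cast
        rw [div_sub_div _ _ hN'.ne' (by positivity), inv_eq_one_div,
          div_le_div_iff₀ (by positivity) (by positivity)]
        nlinarith
      linarith
  have h2 : (0 : ℝ) ≤ 1 / N := by positivity
  linarith

/-- Distinct positive integers have a large product: `k log (k / 2) ≤ 2 ∑ log v`. -/
lemma card_mul_log_card_le {K : Finset ℕ} (hK : K.Nonempty) (hpos : ∀ v ∈ K, 1 ≤ v) :
    (K.card : ℝ) * Real.log K.card ≤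
      2 * ∑ v ∈ K, Real.log v + K.card * Real.log 2 := by
  have hk : (0 : ℝ) < K.card := by exact_mod_cast hK.card_pos
  have hterm : ∀ v ∈ K, Real.log K.card - Real.log 2 - 2 * Real.log v ≤
      K.card / 2 * ((v : ℝ) ^ 2)⁻¹ - 1 := by
    intro v hv
    have hv' : (0 : ℝ) < v := by exact_mod_cast hpos v hv
    have h := Real.log_le_sub_one_of_pos (x := K.card / 2 * ((v : ℝ) ^ 2)⁻¹) (by positivity)
    rwa [Real.log_mul (by positivity) (by positivity), Real.log_div hk.ne' two_ne_zero,
      Real.log_inv, Real.log_pow, Nat.cast_ofNat, ← sub_eq_add_neg] at h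
  have hsum := Finset.sum_le_sum hterm
  have hsq : ∑ v ∈ K, ((v : ℝ) ^ 2)⁻¹ ≤ 2 := by
    refine le_trans (Finset.sum_le_sum_of_subset_of_nonneg (fun v hv => ?_)
      fun _ _ _ => by positivity) (sum_Icc_inv_sq_le (K.sup id))
    exact Finset.mem_Icc.mpr ⟨hpos v hv, Finset.le_sup (f := id) hv⟩
  simp only [Finset.sum_sub_distrib, ← Finset.mul_sum, Finset.sum_const, nsmul_eq_mul] at hsum
  have : (K.card : ℝ) / 2 * ∑ v ∈ K, ((v : ℝ) ^ 2)⁻¹ ≤ K.card / 2 * 2 := by gcongr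
  linarith

lemma log_le_weight {v : ℕ} (hv : 1 ≤ v) : Real.log v ≤ weight v := by
  have h1 : v < 2 ^ weight v := Nat.lt_pow_succ_log_self one_lt_two v
  have h2 : (v : ℝ) ≤ 2 ^ weight v := by exact_mod_cast h1.le
  have hv' : (0 : ℝ) < v := by exact_mod_cast hv
  have h3 := Real.log_le_log hv' h2
  rw [Real.log_pow] at h3
  have := Real.log_two_lt_d9
  nlinarith [Nat.cast_nonneg (α := ℝ) (weight v)]

/-- The expected number of successes up to a critical time outweighs the logarithm of the number of
choices of the IDs, of the wake-up times, and of the critical time itself. -/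
lemma IsCritical.entropy_le {K : Finset ℕ} {ω : ℕ → ℕ} {s τ : ℕ} (h : IsCritical K ω s τ) :
    2 * ∑ v ∈ K, Real.log v + (K.card + 5) * Real.log (τ + 1) ≤
      256 * ((τ : ℝ) / (delayConst * 2 ^ scaleIndex K.card)) := by
  have hkpos : 1 ≤ K.card := h.nonempty.card_pos
  have hA := two_pow_scaleIndex_le_mul hkpos
  set A := 2 ^ scaleIndex K.card with hAdef
  have hAcast : (2 : ℝ) ^ scaleIndex K.card = A := by rw [hAdef]; push_cast; rfl
  rw [hAcast]
  have hApos : (0 : ℝ) < A := by rw [← hAcast]; positivity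
  have hCdef : (delayConst : ℝ) = 2 ^ 24 := by norm_num [delayConst]
  obtain ⟨k, hk⟩ : ∃ k : ℝ, k = K.card := ⟨_, rfl⟩
  obtain ⟨D, hD⟩ : ∃ D : ℝ, D = τ / (delayConst * A) := ⟨_, rfl⟩
  rw [← hk, ← hD]
  have hk1 : (1 : ℝ) ≤ k := by rw [hk]; exact_mod_cast hkpos
  have hAk : (A : ℝ) ≤ 8 * k := by rw [hk]; exact_mod_cast hA
  have hWD : ((∑ v ∈ K, weight v : ℕ) : ℝ) ≤ D := by
    rw [hD, le_div_iff₀ (by rw [hCdef]; positivity)]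
    have := h.delay_le
    have h1 : ((delayConst * A * ∑ v ∈ K, weight v : ℕ) : ℝ) ≤ τ := by exact_mod_cast this
    push_cast at h1 ⊢
    linarith
  have hkW : k ≤ D := by
    refine le_trans ?_ hWD
    have : K.card ≤ ∑ v ∈ K, weight v := by
      simpa using Finset.card_nsmul_le_sum K weight 1 fun v _ => weight_pos v
    rw [hk]
    exact_mod_cast this
  have hlogv : ∑ v ∈ K, Real.log v ≤ D := by
    refine le_trans ?_ hWD
    push_cast
    exact Finset.sum_le_sum fun v hv => log_le_weight (h.pos v hv)
  have hDpos : 0 < D := by linarith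
  have hτ : (τ : ℝ) = delayConst * A * D := by
    rw [hD]; field_simp
  have hl2 := Real.log_two_lt_d9
  have hl2' := Real.log_two_gt_d9
  have hlog : Real.log (τ + 1) ≤ 20 + Real.log k + Real.log D := by
    have h1 : (τ : ℝ) + 1 ≤ 2 ^ 28 * k * D := by
      have h2 : (1 : ℝ) ≤ k * D := one_le_mul_of_one_le_of_one_le hk1 (by linarith)
      have h3 : (A : ℝ) * D ≤ 8 * k * D := by gcongr
      rw [hτ, hCdef]
      linarith
    have h2 := Real.log_le_log (by positivity) h1
    rw [Real.log_mul (by positivity) (by positivity), Real.log_mul (by positivity) (by positivity),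
      Real.log_pow] at h2
    push_cast at h2
    linarith
  have hcard := card_mul_log_card_le h.nonempty h.pos
  rw [← hk] at hcard
  -- `k log D = k log k + k log (D / k)`, and the last term is at most `D`.
  have hkD : k * Real.log D ≤ k * Real.log k + D := by
    have h1 := Real.log_le_sub_one_of_pos (x := D / k) (by positivity)
    rw [Real.log_div hDpos.ne' (by positivity)] at h1
    have h2 : k * (Real.log D - Real.log k) ≤ k * (D / k) := by gcongr; linarith
    rw [mul_div_cancel₀ D (by positivity : k ≠ 0)] at h2
    linarith
  have hlogτ : 0 ≤ Real.log (τ + 1) := Real.log_nonneg (by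
    have := Nat.cast_nonneg (α := ℝ) τ
    linarith)
  have hk5 : (k + 5) * Real.log (τ + 1) ≤ 6 * (k * (20 + Real.log k + Real.log D)) := by
    calc (k + 5) * Real.log (τ + 1) ≤ (6 * k) * Real.log (τ + 1) := by gcongr; linarith
      _ ≤ (6 * k) * (20 + Real.log k + Real.log D) := by gcongr
      _ = _ := by ring
  have hkl2 : k * Real.log 2 ≤ D := by nlinarith
  nlinarith

/-! ### Independent random bits -/

section RandomBits

open MeasureTheory ProbabilityTheory

variable {ι α : Type*} [DecidableEq α]

/-- The law of independent random bits that are `true` with the probabilities `p`. -/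
noncomputable def bitMeasure (p : ι → unitInterval) : Measure (ι → Bool) :=
  Measure.infinitePi fun i => bernoulliMeasure true false (p i)

instance (p : ι → unitInterval) : IsProbabilityMeasure (bitMeasure p) := by
  unfold bitMeasure; infer_instance

/-- The event that exactly one of the bits `a v`, `v ∈ K`, is `true`. -/
def soloEvent (K : Finset α) (a : α → ι) : Set (ι → Bool) :=
  ⋃ v ∈ K, {X | X (a v) = true} ∩ ⋂ u ∈ K.erase v, {X | X (a u) = false}

lemma mem_soloEvent {K : Finset α} {a : α → ι} {X : ι → Bool} :
    X ∈ soloEvent K a ↔ (K.filter fun v => X (a v) = true).card = 1 := by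
  simp only [soloEvent, Set.mem_iUnion, Set.mem_inter_iff, Set.mem_iInter,
    Finset.mem_erase, exists_prop, Finset.card_eq_one]
  constructor
  · rintro ⟨v, hv, h1, h2⟩
    refine ⟨v, Finset.ext fun u => ?_⟩
    rw [Finset.mem_filter, Finset.mem_singleton]
    refine ⟨fun ⟨hu, hu'⟩ => ?_, fun h => h ▸ ⟨hv, h1⟩⟩
    by_contra hne
    have h3 : X (a u) = false := h2 u ⟨hne, hu⟩
    rw [h3] at hu'
    exact absurd hu' (by simp)
  · rintro ⟨v, hv⟩
    have hmem : v ∈ K.filter fun v => X (a v) = true := hv ▸ Finset.mem_singleton_self v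
    refine ⟨v, (Finset.mem_filter.mp hmem).1, (Finset.mem_filter.mp hmem).2, fun u hu => ?_⟩
    rw [Set.mem_ofPred_eq, ← Bool.not_eq_true]
    intro h
    exact hu.1 (Finset.mem_singleton.mp (hv ▸ Finset.mem_filter.mpr ⟨hu.2, h⟩))

lemma measurableSet_soloEvent_of {m : MeasurableSpace (ι → Bool)} {K : Finset α} {a : α → ι}
    (h : ∀ v ∈ K, ∀ y : Bool, MeasurableSet[m] {X | X (a v) = y}) :
    MeasurableSet[m] (soloEvent K a) :=
  K.measurableSet_biUnion fun v hv => (h v hv true).inter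
    ((K.erase v).measurableSet_biInter fun u hu => h u (Finset.mem_of_mem_erase hu) false)

lemma measurableSet_bit (i : ι) (y : Bool) : MeasurableSet {X : ι → Bool | X i = y} := by
  have h : Measurable fun X : ι → Bool => X i := measurable_pi_apply i
  exact h (measurableSet_singleton y)

lemma exactlyOneProb_le_measureReal_soloEvent (p : ι → unitInterval) {K : Finset α} {a : α → ι}
    (ha : Set.InjOn a K) :
    exactlyOneProb K (fun v => (p (a v) : ℝ)) ≤ (bitMeasure p).real (soloEvent K a) := by
  classical
  rw [soloEvent, measureReal_biUnion_finset, exactlyOneProb]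
  · refine Finset.sum_le_sum fun v hv => le_of_eq ?_
    have hset : ({X : ι → Bool | X (a v) = true} ∩ ⋂ u ∈ K.erase v, {X | X (a u) = false}) =
        Set.pi (K.image a : Finset ι) (fun i => if i = a v then {true} else {false}) := by
      ext X
      simp only [Set.mem_inter_iff, Set.mem_ofPred_eq, Set.mem_iInter, Finset.mem_erase, Set.mem_pi,
        Finset.coe_image, Set.mem_image, Finset.mem_coe]
      constructor
      · rintro ⟨h1, h2⟩ _ ⟨u, hu, rfl⟩
        by_cases huv : u = v
        · subst huv; simpa using h1
        · rw [if_neg fun h => huv (ha hu hv h)]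
          exact h2 u ⟨huv, hu⟩
      · intro h
        refine ⟨by simpa using h (a v) ⟨v, hv, rfl⟩, fun u hu => ?_⟩
        have := h (a u) ⟨u, hu.2, rfl⟩
        rwa [if_neg fun h' => hu.1 (ha hu.2 hv h')] at this
    rw [hset, measureReal_def, bitMeasure, Measure.infinitePi_pi, Finset.prod_image ha,
      ENNReal.toReal_prod, ← Finset.mul_prod_erase K _ hv]
    · congr 1
      · rw [if_pos rfl, ← measureReal_def, bernoulliMeasure_real_apply _ (measurableSet_singleton _)]
        simp
      · refine Finset.prod_congr rfl fun u hu => ?_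
        have hu' := Finset.mem_erase.mp hu
        rw [if_neg fun h => hu'.1 (ha hu'.2 hv h), ← measureReal_def,
          bernoulliMeasure_real_apply _ (measurableSet_singleton _)]
        simp
    · intro i _
      split_ifs <;> exact measurableSet_singleton _
  · intro v hv v' hv' hvv'
    refine Set.disjoint_left.mpr fun X hX hX' => ?_
    simp only [Set.mem_inter_iff, Set.mem_ofPred_eq, Set.mem_iInter, Finset.mem_erase] at hX hX'
    have := hX.2 v' ⟨Ne.symm hvv', hv'⟩
    rw [hX'.1] at this
    exact absurd this (by simp)
  · intro v _
    exact (measurableSet_bit _ _).inter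
      ((K.erase v).measurableSet_biInter fun u _ => measurableSet_bit _ _)

/-- Events that depend on disjoint sets of bits are independent. -/
lemma measureReal_biInter_of_disjoint_bits (p : ι → unitInterval) {κ : Type*} [DecidableEq κ]
    (J : Finset κ) (S : κ → Set ι) (E : κ → Set (ι → Bool))
    (hE : ∀ j ∈ J, MeasurableSet[⨆ i ∈ S j, MeasurableSpace.comap (fun X : ι → Bool => X i) ⊤] (E j))
    (hS : ∀ j ∈ J, ∀ j' ∈ J, j ≠ j' → Disjoint (S j) (S j')) :
    (bitMeasure p).real (⋂ j ∈ J, E j) = ∏ j ∈ J, (bitMeasure p).real (E j) := by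
  induction J using Finset.induction_on with
  | empty => simp
  | insert j J hj ih =>
    have hindep : iIndep (fun i => MeasurableSpace.comap (fun X : ι → Bool => X i) ⊤)
        (bitMeasure p) :=
      iIndepFun_infinitePi (P := fun i => bernoulliMeasure true false (p i))
        (X := fun _ x => x) (fun _ => measurable_id)
    have hle : ∀ i : ι, MeasurableSpace.comap (fun X : ι → Bool => X i) ⊤ ≤
        (inferInstance : MeasurableSpace (ι → Bool)) := fun i => by
      have := (measurable_pi_apply (X := fun _ : ι => Bool) i).comap_le
      exact this
    have hdisj : Disjoint (S j) (⋃ j' ∈ J, S j') := by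
      rw [Set.disjoint_iUnion₂_right]
      intro j' hj'
      exact hS j (Finset.mem_insert_self _ _) j' (Finset.mem_insert_of_mem hj')
        (by rintro rfl; exact hj hj')
    have hI := indep_iSup_of_disjoint hle hindep hdisj
    have h2 : MeasurableSet[⨆ i ∈ ⋃ j' ∈ J, S j',
        MeasurableSpace.comap (fun X : ι → Bool => X i) ⊤] (⋂ j' ∈ J, E j') := by
      refine J.measurableSet_biInter fun j' hj' => ?_
      have hle' : (⨆ i ∈ S j', MeasurableSpace.comap (fun X : ι → Bool => X i) ⊤) ≤
          ⨆ i ∈ ⋃ j' ∈ J, S j', MeasurableSpace.comap (fun X : ι → Bool => X i) ⊤ :=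
        biSup_mono fun i hi => Set.mem_biUnion (s := (J : Set κ)) hj' hi
      exact hle' _ (hE j' (Finset.mem_insert_of_mem hj'))
    have h3 := (Indep_iff _ _ _).mp hI _ _ (hE j (Finset.mem_insert_self _ _)) h2
    rw [Finset.set_biInter_insert, Finset.prod_insert hj, measureReal_def, h3, ENNReal.toReal_mul,
      ← measureReal_def, ← measureReal_def, ih (fun j' hj' => hE j' (Finset.mem_insert_of_mem hj'))
        (fun j₁ h₁ j₂ h₂ => hS j₁ (Finset.mem_insert_of_mem h₁) j₂ (Finset.mem_insert_of_mem h₂))]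

/-- The probability that none of several solo events on disjoint sets of bits occurs. -/
lemma measureReal_biInter_compl_soloEvent_le (p : ι → unitInterval) {κ : Type*} [DecidableEq κ]
    (J : Finset κ) (K : κ → Finset α) (a : κ → α → ι) (ha : ∀ j ∈ J, Set.InjOn (a j) (K j))
    (hdisj : ∀ j ∈ J, ∀ j' ∈ J, j ≠ j' → ∀ v ∈ K j, ∀ v' ∈ K j', a j v ≠ a j' v') :
    (bitMeasure p).real (⋂ j ∈ J, (soloEvent (K j) (a j))ᶜ) ≤
      Real.exp (-∑ j ∈ J, exactlyOneProb (K j) fun v => (p (a j v) : ℝ)) := by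
  rw [measureReal_biInter_of_disjoint_bits p J (fun j => a j '' K j)]
  · rw [← Finset.sum_neg_distrib, Real.exp_sum]
    refine Finset.prod_le_prod (fun _ _ => measureReal_nonneg) fun j hj => ?_
    have hmeas : MeasurableSet (soloEvent (K j) (a j)) :=
      measurableSet_soloEvent_of fun v _ y => measurableSet_bit _ y
    rw [probReal_compl_eq_one_sub hmeas]
    have h1 := exactlyOneProb_le_measureReal_soloEvent p (ha j hj)
    have h2 := Real.add_one_le_exp (-exactlyOneProb (K j) fun v => (p (a j v) : ℝ))
    linarith
  · intro j _
    refine MeasurableSet.compl (measurableSet_soloEvent_of fun v hv y => ?_)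
    have hle : MeasurableSpace.comap (fun X : ι → Bool => X (a j v)) ⊤ ≤
        ⨆ i ∈ a j '' K j, MeasurableSpace.comap (fun X : ι → Bool => X i) ⊤ :=
      le_biSup (fun i => MeasurableSpace.comap (fun X : ι → Bool => X i) ⊤)
        (Set.mem_image_of_mem (a j) hv)
    exact hle _ ⟨{y}, trivial, rfl⟩
  · intro j hj j' hj' hjj'
    rw [Set.disjoint_left]
    rintro _ ⟨v, hv, rfl⟩ ⟨v', hv', h⟩
    exact hdisj j hj j' hj' hjj' v hv v' hv' h.symm

end RandomBits

/-! ### The random schedule -/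

section RandomSchedule

open MeasureTheory

/-- The index of a random bit: an ID, an age, a class and an attenuation level. -/
abbrev BitIndex : Type := ℕ × ℕ × ℕ × ℕ

/-- The bit that decides whether the node with ID `v`, woken in time-step `w`, transmits in
time-step `j`. -/
def bitIndex (v w j : ℕ) : BitIndex :=
  (v, j - w, ageClass (weight v) (j - w) j, j % period (ageClass (weight v) (j - w) j))

/-- The probabilities of the random bits. -/
noncomputable def bitProb (b : BitIndex) : unitInterval :=
  ⟨levelProb (weight b.1) b.2.1 b.2.2.1 b.2.2.2, levelProb_nonneg .., (levelProb_le_half ..).trans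
    (by norm_num)⟩

/-- The schedule determined by a choice of bits. -/
def bitSchedule (X : BitIndex → Bool) (v w j : ℕ) : Bool := decide (w ≤ j) && X (bitIndex v w j)

lemma stepProb_eq_bitProb {v w j : ℕ} (h : w ≤ j) :
    stepProb (weight v) w j = bitProb (bitIndex v w j) := by
  rw [stepProb, if_pos h]; rfl

/-- The event that in no time-step from `s` up to `s + τ` exactly one node of `K` transmits. -/
def failEvent (K : Finset ℕ) (ω : ℕ → ℕ) (s τ : ℕ) : Set (BitIndex → Bool) :=
  {X | ∀ j ∈ Finset.Ico s (s + τ), (K.filter fun v => bitSchedule X v (ω v) j = true).card ≠ 1}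

/-- Indices of probability zero do not matter. -/
lemma exactlyOneProb_filter {α : Type*} [DecidableEq α] (K : Finset α) (p : α → ℝ) (P : α → Prop)
    [DecidablePred P] (hP : ∀ v ∈ K, ¬ P v → p v = 0) :
    exactlyOneProb (K.filter P) p = exactlyOneProb K p := by
  have hprod : ∀ v, ∏ u ∈ (K.filter P).erase v, (1 - p u) = ∏ u ∈ K.erase v, (1 - p u) := by
    intro v
    refine Finset.prod_subset (Finset.erase_subset_erase v (Finset.filter_subset _ _))
      fun u hu hu' => ?_
    rw [Finset.mem_erase] at hu
    rw [hP u hu.2 fun h => hu' (Finset.mem_erase.mpr ⟨hu.1, Finset.mem_filter.mpr ⟨hu.2, h⟩⟩),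
      sub_zero]
  rw [exactlyOneProb, exactlyOneProb]
  simp_rw [hprod]
  refine Finset.sum_subset (Finset.filter_subset _ _) fun v hv hv' => ?_
  rw [hP v hv fun h => hv' (Finset.mem_filter.mpr ⟨hv, h⟩), zero_mul]

lemma measureReal_failEvent_le (K : Finset ℕ) (ω : ℕ → ℕ) (s τ : ℕ) :
    (bitMeasure bitProb).real (failEvent K ω s τ) ≤
      Real.exp (-∑ j ∈ Finset.Ico s (s + τ), soloProb K ω j) := by
  have hset : failEvent K ω s τ = ⋂ j ∈ Finset.Ico s (s + τ),
      (soloEvent (K.filter fun v => ω v ≤ j) fun v => bitIndex v (ω v) j)ᶜ := by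
    ext X
    simp only [failEvent, Set.mem_ofPred_eq, Set.mem_iInter, Set.mem_compl_iff, mem_soloEvent,
      Finset.filter_filter, bitSchedule, Bool.and_eq_true, decide_eq_true_eq, ne_eq]
  have hprob : ∀ j, soloProb K ω j = exactlyOneProb (K.filter fun v => ω v ≤ j)
      fun v => (bitProb (bitIndex v (ω v) j) : ℝ) := by
    intro j
    rw [soloProb, ← exactlyOneProb_filter K _ (fun v => ω v ≤ j)
      fun v _ hv => by rw [stepProb, if_neg hv]]
    refine Finset.sum_congr rfl fun v hv => ?_
    beta_reduce
    rw [stepProb_eq_bitProb (Finset.mem_filter.mp hv).2]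
    refine congrArg _ (Finset.prod_congr rfl fun u hu => ?_)
    rw [stepProb_eq_bitProb (Finset.mem_filter.mp (Finset.mem_of_mem_erase hu)).2]
  rw [hset, Finset.sum_congr rfl fun j _ => hprob j]
  refine measureReal_biInter_compl_soloEvent_le bitProb _ _ (fun j v => bitIndex v (ω v) j) ?_ ?_
  · intro j _ v _ v' _ h
    exact congrArg Prod.fst h
  · intro j _ j' _ hjj' v hv v' hv' h
    have h1 : v = v' := congrArg Prod.fst h
    have h2 : j - ω v = j' - ω v' := congrArg (fun b => b.2.1) h
    subst h1
    have h3 := (Finset.mem_filter.mp hv).2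
    have h4 := (Finset.mem_filter.mp hv').2
    omega

/-! ### Invariance under shifts of the clock -/

lemma ageClass_le_of_mod_eq {ℓ x j j' : ℕ} (hℓ : 1 ≤ ℓ)
    (h : j % period (ageClass ℓ x j) = j' % period (ageClass ℓ x j)) :
    ageClass ℓ x j ≤ ageClass ℓ x j' := by
  rcases Nat.eq_zero_or_pos (ageClass ℓ x j) with h0 | h0
  · omega
  · have h1 := ageClass_spec h0
    exact le_ageClass hℓ (by omega)

lemma period_ageClass_dvd {ℓ x j τ : ℕ} (hℓ : 1 ≤ ℓ) (hx : x ≤ τ) (hτ : 4 ≤ τ) :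
    period (ageClass ℓ x j) ∣ 2 ^ Nat.log 2 τ := by
  refine pow_dvd_pow 2 (Nat.le_log_of_pow_le one_lt_two ?_)
  rcases Nat.eq_zero_or_pos (ageClass ℓ x j) with h | h
  · rw [h]; simpa using hτ
  · have h1 := ageClass_spec h
    have h2 : period (ageClass ℓ x j) ≤ threshold (ageClass ℓ x j) := period_le_threshold h
    have h3 := Nat.le_mul_of_pos_left (threshold (ageClass ℓ x j)) hℓ
    change period (ageClass ℓ x j) ≤ τ
    omega

/-- Up to age `τ`, the schedule depends on the clock only modulo a power of two below `τ`. -/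
lemma bitSchedule_add (X : BitIndex → Bool) {v w j z τ : ℕ} (hz : 2 ^ Nat.log 2 τ ∣ z)
    (hτ : 4 ≤ τ) (hj : j ≤ w + τ) :
    bitSchedule X v (z + w) (z + j) = bitSchedule X v w j := by
  have hx : z + j - (z + w) = j - w := by omega
  have hmod : ∀ j₀, (z + j) % period (ageClass (weight v) (j - w) j₀) =
      j % period (ageClass (weight v) (j - w) j₀) := by
    intro j₀
    obtain ⟨c, hc⟩ :=
      (period_ageClass_dvd (j := j₀) (weight_pos v) (by omega : j - w ≤ τ) hτ).trans hz
    rw [hc, Nat.mul_add_mod]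
  have hcls : ageClass (weight v) (j - w) (z + j) = ageClass (weight v) (j - w) j :=
    le_antisymm (ageClass_le_of_mod_eq (weight_pos v) (hmod (z + j)))
      (ageClass_le_of_mod_eq (weight_pos v) (hmod j).symm)
  rw [bitSchedule, bitSchedule, bitIndex, bitIndex, hx, hcls, hmod]
  simp

lemma IsCritical.shift {K : Finset ℕ} {ω : ℕ → ℕ} {z s τ : ℕ}
    (h : IsCritical K ω (z + s) τ) : IsCritical K (fun v => ω v - z) s τ := by
  refine ⟨h.nonempty, h.pos, fun v hv => ?_, fun v hv => ?_, h.delay_le, fun t ht => ?_⟩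
  · have := h.le_wake v hv; omega
  · have := h.wake_le v hv; omega
  · have h1 := h.le_delay t ht
    have h2 : (K.filter fun v => ω v - z ≤ s + t) = K.filter fun v => ω v ≤ z + s + t :=
      Finset.filter_congr fun v _ => by omega
    rwa [h2]

lemma IsCritical.delayConst_le {K : Finset ℕ} {ω : ℕ → ℕ} {s τ : ℕ} (h : IsCritical K ω s τ) :
    delayConst ≤ τ := by
  refine le_trans ?_ h.delay_le
  have h1 : 0 < ∑ v ∈ K, weight v := Finset.sum_pos (fun v _ => weight_pos v) h.nonempty
  rw [mul_assoc]
  exact Nat.le_mul_of_pos_right _ (by positivity)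

/-! ### The union bound -/

/-- The event that the nodes and offsets in `G` form an instance with critical time `τ` and start
`s` for which the schedule fails. -/
def badEvent (τ s : ℕ) (G : Finset (ℕ × ℕ)) : Set (BitIndex → Bool) :=
  {X | ∃ K ω, IsCritical K ω s τ ∧ G = K.image (fun v => (v, ω v - s)) ∧ X ∈ failEvent K ω s τ}

lemma measureReal_badEvent_le (τ s : ℕ) (G : Finset (ℕ × ℕ)) :
    (bitMeasure bitProb).real (badEvent τ s G) ≤
      (∏ g ∈ G, ((g.1 : ℝ) ^ 2)⁻¹ * ((τ : ℝ) + 1)⁻¹) * (((τ : ℝ) + 1) ^ 5)⁻¹ := by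
  by_cases hex : ∃ K ω, IsCritical K ω s τ ∧ G = K.image (fun v => (v, ω v - s))
  swap
  · have : badEvent τ s G = ∅ := by
      refine Set.eq_empty_of_forall_notMem fun X ⟨K, ω, h1, h2, _⟩ => hex ⟨K, ω, h1, h2⟩
    rw [this, measureReal_empty]
    exact mul_nonneg (Finset.prod_nonneg fun _ _ => by positivity) (by positivity)
  obtain ⟨K, ω, hcrit, hG⟩ := hex
  have hsub : badEvent τ s G ⊆ failEvent K ω s τ := by
    rintro X ⟨K', ω', hcrit', hG', hX⟩
    have hmem : ∀ v o, (v, o) ∈ G ↔ v ∈ K ∧ ω v - s = o := by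
      intro v o; rw [hG]; simp
    have hmem' : ∀ v o, (v, o) ∈ G ↔ v ∈ K' ∧ ω' v - s = o := by
      intro v o; rw [hG']; simp
    have hKK' : K = K' := by
      ext v
      exact ⟨fun hv => ((hmem' v _).mp ((hmem v _).mpr ⟨hv, rfl⟩)).1,
        fun hv => ((hmem v _).mp ((hmem' v _).mpr ⟨hv, rfl⟩)).1⟩
    subst hKK'
    have hωω' : ∀ v ∈ K, ω v = ω' v := by
      intro v hv
      have h1 := ((hmem' v _).mp ((hmem v _).mpr ⟨hv, rfl⟩)).2
      have h2 := hcrit.le_wake v hv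
      have h3 := hcrit'.le_wake v hv
      omega
    intro j hj
    rw [Finset.filter_congr fun v hv => by rw [hωω' v hv]]
    exact hX j hj
  refine (measureReal_mono hsub).trans ((measureReal_failEvent_le K ω s τ).trans ?_)
  have hsum := le_sum_soloProb hcrit.nonempty hcrit.le_wake hcrit.delay_le hcrit.le_delay
    (scaleIndex_spec K.card)
  have hent := hcrit.entropy_le
  have hτ : (0 : ℝ) < τ + 1 := by positivity
  have hinj : Set.InjOn (fun v => (v, ω v - s)) (K : Set ℕ) := fun v _ v' _ h =>
    congrArg Prod.fst h
  rw [hG, Finset.prod_image hinj, Finset.prod_mul_distrib, Finset.prod_const]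
  refine (Real.exp_le_exp.mpr (neg_le_neg (hent.trans hsum))).trans (le_of_eq ?_)
  have h1 : ∏ v ∈ K, ((v : ℝ) ^ 2)⁻¹ = Real.exp (-(2 * ∑ v ∈ K, Real.log v)) := by
    rw [Finset.mul_sum, ← Finset.sum_neg_distrib, Real.exp_sum]
    refine Finset.prod_congr rfl fun v hv => ?_
    have hv' : (0 : ℝ) < v := by exact_mod_cast hcrit.pos v hv
    rw [Real.exp_neg, ← Real.log_rpow hv', Real.exp_log (by positivity)]
    norm_cast
  have h2 : Real.exp (-((K.card + 5 : ℕ) * Real.log (τ + 1))) = (((τ : ℝ) + 1) ^ (K.card + 5))⁻¹ := by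
    rw [Real.exp_neg, ← Real.log_pow, Real.exp_log (by positivity)]
  rw [h1, inv_pow, mul_assoc, ← mul_inv, ← pow_add, ← h2, ← Real.exp_add]
  push_cast
  congr 1
  ring

/-- The nodes and offsets that can occur in an instance with critical time `τ`. -/
def nodeRange (τ : ℕ) : Finset (ℕ × ℕ) := Finset.Icc 1 (2 ^ τ) ×ˢ Finset.range (τ + 1)

lemma mem_powerset_nodeRange {K : Finset ℕ} {ω : ℕ → ℕ} {s τ : ℕ} (h : IsCritical K ω s τ) :
    K.image (fun v => (v, ω v - s)) ∈ (nodeRange τ).powerset := by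
  rw [Finset.mem_powerset]
  intro g hg
  obtain ⟨v, hv, rfl⟩ := Finset.mem_image.mp hg
  have h1 := h.wake_le v hv
  have h2 : weight v ≤ τ := by
    refine (Finset.single_le_sum (f := weight) (fun _ _ => Nat.zero_le _) hv).trans
      (le_trans ?_ h.delay_le)
    exact Nat.le_mul_of_pos_left _ (Nat.mul_pos (by norm_num [delayConst]) (by positivity))
  have h3 : v < 2 ^ weight v := Nat.lt_pow_succ_log_self one_lt_two v
  have h4 : 2 ^ weight v ≤ 2 ^ τ := Nat.pow_le_pow_right two_pos h2
  rw [nodeRange, Finset.mem_product, Finset.mem_Icc, Finset.mem_range]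
  exact ⟨⟨h.pos v hv, by omega⟩, by omega⟩

/-- The event that the schedule fails for some instance with critical time `τ` and a start
`s ≤ τ`; other starts reduce to these by a shift of the clock. -/
def badEventAt (τ : ℕ) : Set (BitIndex → Bool) :=
  ⋃ s ∈ Finset.range (τ + 1), ⋃ G ∈ (nodeRange τ).powerset, badEvent τ s G

lemma measureReal_badEventAt_le (τ : ℕ) :
    (bitMeasure bitProb).real (badEventAt τ) ≤ 1 / (2 * ((τ + 1) * (τ + 2))) := by
  rcases Nat.lt_or_ge τ delayConst with hτ | hτ
  · have : badEventAt τ = ∅ := by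
      refine Set.eq_empty_of_forall_notMem fun X hX => ?_
      simp only [badEventAt, Set.mem_iUnion] at hX
      obtain ⟨s, _, G, _, K, ω, hcrit, _⟩ := hX
      exact absurd hcrit.delayConst_le (by omega)
    rw [this, measureReal_empty]
    positivity
  have hpos : (0 : ℝ) < τ + 1 := by positivity
  have hG : ∑ G ∈ (nodeRange τ).powerset, ∏ g ∈ G, ((g.1 : ℝ) ^ 2)⁻¹ * ((τ : ℝ) + 1)⁻¹ ≤ 8 := by
    rw [← Finset.prod_one_add]
    calc ∏ g ∈ nodeRange τ, (1 + ((g.1 : ℝ) ^ 2)⁻¹ * ((τ : ℝ) + 1)⁻¹)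
        ≤ ∏ g ∈ nodeRange τ, Real.exp (((g.1 : ℝ) ^ 2)⁻¹ * ((τ : ℝ) + 1)⁻¹) := by
          refine Finset.prod_le_prod (fun _ _ => by positivity) fun g _ => ?_
          rw [add_comm]
          exact Real.add_one_le_exp _
      _ = Real.exp (∑ g ∈ nodeRange τ, ((g.1 : ℝ) ^ 2)⁻¹ * ((τ : ℝ) + 1)⁻¹) :=
          (Real.exp_sum _ _).symm
      _ ≤ Real.exp 2 := by
          refine Real.exp_le_exp.mpr ?_
          rw [nodeRange, Finset.sum_product]
          refine le_trans (le_of_eq ?_) (sum_Icc_inv_sq_le (2 ^ τ))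
          refine Finset.sum_congr rfl fun v _ => ?_
          simp only [Finset.sum_const, Finset.card_range, nsmul_eq_mul]
          push_cast
          field_simp
      _ ≤ 8 := by
          have h1 : Real.exp 2 = Real.exp 1 ^ 2 := by rw [← Real.exp_nat_mul]; norm_num
          rw [h1]
          calc Real.exp 1 ^ 2 ≤ 2.8 ^ 2 := by
                gcongr
                linarith [Real.exp_one_lt_d9]
            _ ≤ 8 := by norm_num
  calc (bitMeasure bitProb).real (badEventAt τ)
      ≤ ∑ s ∈ Finset.range (τ + 1), ∑ G ∈ (nodeRange τ).powerset,
          (bitMeasure bitProb).real (badEvent τ s G) :=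
        (measureReal_biUnion_finset_le _ _).trans
          (Finset.sum_le_sum fun s _ => measureReal_biUnion_finset_le _ _)
    _ ≤ ∑ s ∈ Finset.range (τ + 1), ∑ G ∈ (nodeRange τ).powerset,
          (∏ g ∈ G, ((g.1 : ℝ) ^ 2)⁻¹ * ((τ : ℝ) + 1)⁻¹) * (((τ : ℝ) + 1) ^ 5)⁻¹ :=
        Finset.sum_le_sum fun s _ => Finset.sum_le_sum fun G _ => measureReal_badEvent_le τ s G
    _ ≤ ∑ s ∈ Finset.range (τ + 1), 8 * (((τ : ℝ) + 1) ^ 5)⁻¹ := by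
        refine Finset.sum_le_sum fun s _ => ?_
        rw [← Finset.sum_mul]
        gcongr
    _ = 8 / ((τ : ℝ) + 1) ^ 4 := by
        rw [Finset.sum_const, Finset.card_range, nsmul_eq_mul]
        push_cast
        field_simp
    _ ≤ _ := by
        rw [div_le_div_iff₀ (by positivity) (by positivity)]
        have h1 : (delayConst : ℝ) ≤ τ := by exact_mod_cast hτ
        have h2 : (16 : ℝ) ≤ τ + 1 := by
          refine le_trans ?_ (h1.trans (by linarith))
          norm_num [delayConst]
        set y : ℝ := τ + 1
        have h3 : (τ : ℝ) + 2 = y + 1 := by simp only [y]; ring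
        rw [h3]
        have h4 : y + 1 ≤ y ^ 2 := by nlinarith
        calc 8 * (2 * (y * (y + 1))) = 16 * y * (y + 1) := by ring
          _ ≤ y * y * y ^ 2 := by gcongr
          _ = 1 * y ^ 4 := by ring

/-- Some choice of the bits avoids all bad events. -/
lemma exists_forall_notMem_badEventAt : ∃ X : BitIndex → Bool, ∀ τ, X ∉ badEventAt τ := by
  by_contra! hcon
  have huniv : (Set.univ : Set (BitIndex → Bool)) ⊆ ⋃ τ, badEventAt τ := fun X _ =>
    Set.mem_iUnion.mpr (hcon X)
  have h1 : (1 : ENNReal) ≤ ∑' τ, bitMeasure bitProb (badEventAt τ) := by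
    rw [← measure_univ (μ := bitMeasure bitProb)]
    exact (measure_mono huniv).trans (measure_iUnion_le _)
  have h2 : ∑' τ, bitMeasure bitProb (badEventAt τ) ≤ ENNReal.ofReal (1 / 2) := by
    refine ENNReal.tsum_le_of_sum_range_le fun n => ?_
    have h3 : ∀ τ ∈ Finset.range n, bitMeasure bitProb (badEventAt τ) =
        ENNReal.ofReal ((bitMeasure bitProb).real (badEventAt τ)) := fun τ _ => by
      rw [measureReal_def, ENNReal.ofReal_toReal (measure_ne_top _ _)]
    rw [Finset.sum_congr rfl h3, ← ENNReal.ofReal_sum_of_nonneg fun _ _ => measureReal_nonneg]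
    refine ENNReal.ofReal_le_ofReal ?_
    have h4 : ∑ τ ∈ Finset.range n, (bitMeasure bitProb).real (badEventAt τ) ≤
        1 / 2 - 1 / (2 * ((n : ℝ) + 1)) := by
      induction n with
      | zero => norm_num
      | succ n ih =>
        rw [Finset.sum_range_succ]
        have h5 := measureReal_badEventAt_le n
        have h6 : (1 : ℝ) / (2 * ((n + 1) * (n + 2))) =
            1 / (2 * ((n : ℝ) + 1)) - 1 / (2 * ((n + 1 : ℕ) + 1)) := by
          push_cast
          field_simp
          ring
        have := ih (fun τ hτ => h3 τ (Finset.mem_range.mpr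
          ((Finset.mem_range.mp hτ).trans n.lt_succ_self)))
        linarith
    have h5 : (0 : ℝ) ≤ 1 / (2 * ((n : ℝ) + 1)) := by positivity
    linarith
  have h3 := h1.trans h2
  rw [ENNReal.one_le_ofReal] at h3
  norm_num at h3

end RandomSchedule

/-! ### Existence of the schedule -/

/-- The weights of an instance exceed the sum of the logarithms only by a constant factor. -/
lemma IsInstance.sum_weight_le {r k : ℕ} {K : Finset ℕ} (h : IsInstance r k K) :
    ∑ v ∈ K, weight v ≤ 2 * r + 1 := by
  obtain ⟨hne, hpos, hcard, hr⟩ := h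
  have h1 : ∑ v ∈ K, Nat.log 2 v ≤ r := by
    rw [← hr]
    refine Nat.le_floor ?_
    push_cast
    exact Finset.sum_le_sum fun v _ => Real.natLog_le_logb v 2
  have h2 : K.card ≤ ∑ v ∈ K, Nat.log 2 v + 1 := by
    have h3 : (K.erase 1).card ≤ ∑ v ∈ K.erase 1, Nat.log 2 v := by
      have := Finset.card_nsmul_le_sum (K.erase 1) (Nat.log 2) 1 fun v hv => by
        obtain ⟨h4, h5⟩ := Finset.mem_erase.mp hv
        have := hpos v h5
        exact Nat.log_pos one_lt_two (by omega)
      simpa using this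
    have h4 : ∑ v ∈ K.erase 1, Nat.log 2 v ≤ ∑ v ∈ K, Nat.log 2 v :=
      Finset.sum_le_sum_of_subset (Finset.erase_subset _ _)
    have h5 := Finset.pred_card_le_card_erase (s := K) (a := 1)
    omega
  have h3 : ∑ v ∈ K, weight v = ∑ v ∈ K, Nat.log 2 v + K.card := by
    simp [weight, Finset.sum_add_distrib]
  omega

/-- A transmission schedule of delay `O(r log log k)` exists: a choice of bits that avoids all bad
events succeeds on the critical instance inside any given one, and the nodes outside it are not yet
awake. -/
theorem exists_isTransmissionSchedule :
    ∃ (T : ℕ → ℕ → ℕ → Bool) (h : ℕ → ℕ → ℕ), IsTransmissionSchedule T h ∧ IsDelayBigO h := by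
  obtain ⟨X, hX⟩ := exists_forall_notMem_badEventAt
  refine ⟨bitSchedule X, fun r k => delayConst * 2 ^ scaleIndex k * (2 * r + 1),
    ⟨fun v w j hjw => by simp [bitSchedule, hjw], fun r k K hK ω => ?_⟩, ?_⟩
  · obtain ⟨hne, hpos, hcard, hr⟩ := id hK
    set s := K.inf' hne ω with hs
    have hle : ∀ v ∈ K, s ≤ ω v := fun v hv => Finset.inf'_le ω hv
    have hmin : ∃ v ∈ K, ω v = s := by
      obtain ⟨v, hv, h⟩ := Finset.exists_mem_eq_inf' hne ω
      exact ⟨v, hv, h.symm⟩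
    obtain ⟨τ, hτ, hcrit⟩ := exists_isCritical hpos hle hmin
    rw [hcard] at hτ
    have hτh : τ ≤ delayConst * 2 ^ scaleIndex k * (2 * r + 1) :=
      hτ.trans (Nat.mul_le_mul_left _ hK.sum_weight_le)
    by_contra! hcon
    have hτ4 : 4 ≤ τ := le_trans (by norm_num [delayConst]) hcrit.delayConst_le
    set K' := K.filter fun v => ω v ≤ s + τ with hK'
    -- The clock is shifted back by a multiple of all the periods in use.
    set P := 2 ^ Nat.log 2 τ with hP
    have hPτ : P ≤ τ := Nat.pow_log_le_self 2 (by omega)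
    have hPpos : 0 < P := by positivity
    set z := P * (s / P) with hz
    have hsz : z + s % P = s := Nat.div_add_mod s P
    have hcrit' : IsCritical K' (fun v => ω v - z) (s % P) τ := by
      apply IsCritical.shift
      rwa [hsz]
    apply hX τ
    simp only [badEventAt, Set.mem_iUnion]
    refine ⟨s % P, Finset.mem_range.mpr ((Nat.mod_lt s hPpos).trans_le (by omega)), _,
      mem_powerset_nodeRange hcrit', K', _, hcrit', rfl, fun j hj => ?_⟩
    obtain ⟨hj1, hj2⟩ := Finset.mem_Ico.mp hj
    have hfilter : (K'.filter fun v => bitSchedule X v (ω v - z) j = true) =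
        K.filter fun v => bitSchedule X v (ω v) (z + j) = true := by
      rw [hK', Finset.filter_filter]
      refine Finset.filter_congr fun v hv => ?_
      have h1 := hle v hv
      have h2 : z + (ω v - z) = ω v := by omega
      have h3 : bitSchedule X v (ω v) (z + j) = bitSchedule X v (ω v - z) j := by
        conv_lhs => rw [← h2]
        exact bitSchedule_add X (Dvd.intro _ rfl) hτ4 (by omega)
      rw [h3]
      refine ⟨fun h => h.2, fun h => ⟨?_, h⟩⟩
      simp only [bitSchedule, Bool.and_eq_true, decide_eq_true_eq] at h
      omega
    rw [hfilter]
    exact hcon (z + j) (by omega)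
  · refine ⟨delayConst * 72, fun r k => ?_⟩
    have h1 := two_pow_scaleIndex_le_logLog k
    have h2 := one_le_logLog k
    push_cast
    have h3 : (2 : ℝ) * r + 1 ≤ 3 * max 1 (r : ℝ) := by
      linarith [le_max_left 1 (r : ℝ), le_max_right 1 (r : ℝ)]
    calc (delayConst : ℝ) * 2 ^ scaleIndex k * (2 * r + 1)
        ≤ delayConst * (24 * logLog k) * (3 * max 1 (r : ℝ)) := by gcongr
      _ = _ := by ring

theorem mainTheorem6 :
    (∃ (T : ℕ → ℕ → ℕ → Bool) (h : ℕ → ℕ → ℕ), IsTransmissionSchedule T h ∧ IsDelayBigO h) ∧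
    ∀ (T : ℕ → ℕ → ℕ → Bool) (h : ℕ → ℕ → ℕ), IsTransmissionSchedule T h → IsDelayBigO h →
      ∃ C : ℝ, ∀ (V : Type*) [Fintype V] (N : RadioNetwork V) (L : ℕ), (∀ v, N.id v ≤ L) →
        ∀ (σ : V → Option ℕ) (t₀ : ℕ), IsLeast {t | ∃ v, σ v = some t} t₀ →
          ∃ t : ℕ,
            (t : ℝ) ≤ t₀ + C * Fintype.card V * Real.logb 2 (L : ℝ) * logLog (Fintype.card V) ∧
            ∀ v, (N.run T σ t v).isSome := by
  exact ⟨exists_isTransmissionSchedule, fun _ _ => broadcast_time⟩
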